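/- Let $p$ be a prime number and let $K$ be a number field that contains no primitive $p$-th root of unity and in which $p$ is unramified. Let $L=K(\omega)$, where $\omega^p\in K$ is not the $p$-th power of an element of $K$, and suppose that $L/K$ is at most tamely ramified. A Hopf–Galois structure on $L/K$ is a cocommutative $K$-Hopf algebra $H$ together with a $K$-linear action of $H$ on $L$ that makes $L$ an $H$-module algebra (i.e. $L$ is a left $H$-module with $h\cdot 1=\varepsilon(h)1$ and $h\cdot(xy)=\sum (h_{(1)}\cdot x)(h_{(2)}\cdot y)$) and for which the map $L\otimes_K H\to \mathrm{End}_K(L)$, $s\otimes h\mapsto (t\mapsto s(h\cdot t))$, is bijective. For a nonzero ideal $\mathfrak a$ of $\mathfrak O_K$, the ideals associated to $\mathfrak a$ are $\mathfrak b_j=\prod_{\mathfrak p}\mathfrak p^{\lfloor j v_{\mathfrak p}(\mathfrak a)/p\rfloor}$ for $0\le j\le p-1$, the product being over the nonzero prime ideals of $\mathfrak O_K$. Then $L/K$ admits a Hopf–Galois structure, and the following holds for the Hopf algebra $H$ of any Hopf–Galois structure on $L/K$ and the associated order $\mathfrak A=\{h\in H: h\cdot \mathfrak O_L\subseteq \mathfrak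 O_L\}$. The ring of integers $\mathfrak O_L$ is a free $\mathfrak A$-module if and only if there exists $\beta\in\mathfrak O_L$ such that 1. $L=K(\beta)$; 2. $b=\beta^p\in\mathfrak O_K$; 3. the ideals $\mathfrak b_0,\dots,\mathfrak b_{p-1}$ associated to $b\mathfrak O_K$ are principal, with generators $b_0,\dots,b_{p-1}\in\mathfrak O_K$ such that $$\sum_{j=0}^{p-1}\frac{\beta^j}{b_j}\equiv 0 \pmod{p\,\mathfrak O_L}.$$ Furthermore, for every such $\beta$ and every such choice of generators $b_j$, the element $$\frac1p\sum_{j=0}^{p-1}\frac{\beta^j}{b_j}$$ is a free generator of $\mathfrak O_L$ as an $\mathfrak A$-module. -/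

import Mathlib

universe u v w

open scoped NumberField TensorProduct

noncomputable section

namespace HopfGaloisRadical

section HopfGalois

variable (K L H : Type*) [Field K] [Field L] [Algebra K L] [Ring H] [HopfAlgebra K H]
  [Module H L] [IsScalarTower K H L]

/-- For `x : L`, the `K`-linear map `H → L`, `h ↦ h • x`. -/
def orbitMap (x : L) : H →ₗ[K] L :=
  (LinearMap.toSpanSingleton H L x).restrictScalars K

/-- The canonical `K`-linear map `L ⊗ H → End_K(L)`, `s ⊗ h ↦ (t ↦ s * (h • t))`. -/
def galoisMap : L ⊗[K] H →ₗ[K] Module.End K L :=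
  TensorProduct.lift ((LinearMap.mul K (Module.End K L)).compl₁₂
    (Algebra.lmul K L).toLinearMap (Algebra.lsmul K K L : H →ₐ[K] Module.End K L).toLinearMap)

/-- The `K`-Hopf algebra `H`, with its `K`-linear action on `L`, gives a Hopf-Galois structure on
`L/K`: `H` is cocommutative, `L` is an `H`-module algebra, and `L ⊗ H → End_K(L)` is bijective. -/
structure IsHopfGalois : Prop where
  cocomm : Coalgebra.IsCocomm K H
  /-- `h • 1 = ε(h) 1` -/
  smul_one : ∀ h : H, h • (1 : L) = algebraMap K L (Coalgebra.counit (R := K) h)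
  /-- `h • (x y) = ∑ (h₍₁₎ • x) (h₍₂₎ • y)` -/
  smul_mul : ∀ (h : H) (x y : L), h • (x * y) =
    LinearMap.mul' K L
      (TensorProduct.map (orbitMap K L H x) (orbitMap K L H y) (Coalgebra.comul (R := K) h))
  bijective : Function.Bijective (galoisMap K L H)

end HopfGalois

section AssociatedOrder

variable (L H : Type*) [Field L] [Ring H] [Module H L]

/-- The associated order `{h ∈ H | h • 𝓞_L ⊆ 𝓞_L}` of `𝓞_L` in `H`. -/
def associatedOrder : Subring H where
  carrier := {h | ∀ x : L, IsIntegral ℤ x → IsIntegral ℤ (h • x)}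
  mul_mem' {a b} ha hb x hx := by rw [mul_smul]; exact ha _ (hb _ hx)
  one_mem' x hx := by rwa [one_smul]
  add_mem' {a b} ha hb x hx := by rw [add_smul]; exact (ha _ hx).add (hb _ hx)
  zero_mem' x _ := by rw [zero_smul]; exact isIntegral_zero
  neg_mem' {a} ha x hx := by rw [neg_smul]; exact (ha _ hx).neg

/-- `𝓞_L` as a module over its associated order, with the action restricted from `L`. -/
instance instModuleAssociatedOrder : Module (associatedOrder L H) (𝓞 L) where
  smul a x := ⟨(a : H) • (x : L), a.2 _ x.2⟩
  one_smul x := Subtype.ext (one_smul H (x : L))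
  mul_smul a b x := Subtype.ext (mul_smul (a : H) (b : H) (x : L))
  smul_zero a := Subtype.ext (smul_zero (a : H))
  smul_add a x y := Subtype.ext (smul_add (a : H) (x : L) (y : L))
  add_smul a b x := Subtype.ext (add_smul (a : H) (b : H) (x : L))
  zero_smul x := Subtype.ext (zero_smul H (x : L))

theorem coe_associatedOrder_smul (a : associatedOrder L H) (x : 𝓞 L) :
    ((a • x : 𝓞 L) : L) = (a : H) • (x : L) := rfl

end AssociatedOrder

/-- `x` is a free generator of the `A`-module `M`, i.e. `{x}` is an `A`-basis of `M`. -/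
def IsFreeGenerator (A : Type*) {M : Type*} [Ring A] [AddCommGroup M] [Module A M] (x : M) : Prop :=
  Function.Bijective fun a : A => a • x

section NumberFields

variable (K L : Type*) [Field K] [Field L] [Algebra K L]

/-- The rational prime `p` is unramified in `K`. -/
def IsUnramifiedIn (p : ℕ) : Prop :=
  ∀ P : Ideal (𝓞 K), P.IsPrime → (p : 𝓞 K) ∈ P → P.ramificationIdx ℤ = 1

/-- `L/K` is at most tamely ramified: no ramification index is divisible by the residue
characteristic. -/
def IsTame : Prop :=
  ∀ P : Ideal (𝓞 L), P.IsPrime → P ≠ ⊥ → ¬ ringChar (𝓞 L ⧸ P) ∣ P.ramificationIdx (𝓞 K)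

variable {K}

open Classical in
/-- The `j`-th ideal associated to a nonzero ideal `I` (with respect to `p`):
the product over the prime divisors `P` of `I` of `P ^ ⌊v_P(I ^ j) / p⌋`. -/
def associatedIdeal [NumberField K] (p : ℕ) (I : Ideal (𝓞 K)) (j : ℕ) : Ideal (𝓞 K) :=
  ∏ P ∈ (UniqueFactorizationMonoid.normalizedFactors I).toFinset,
    P ^ (j * (UniqueFactorizationMonoid.normalizedFactors I).count P / p)

variable {L}

/-- The sum `∑_{j = 0}^{p - 1} β ^ j / c_j` in `L`. -/
def radicalSum (p : ℕ) (β : 𝓞 L) (c : Fin p → 𝓞 K) : L :=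
  ∑ j : Fin p, (β : L) ^ (j : ℕ) / algebraMap K L (c j : K)

/-- The conditions of the criterion, on `β ∈ 𝓞_L` and `c_0, …, c_{p-1} ∈ 𝓞_K`. -/
structure IsCriterionDatum [NumberField K] (p : ℕ) (β : 𝓞 L) (c : Fin p → 𝓞 K) : Prop where
  adjoin_eq_top : IntermediateField.adjoin K {(β : L)} = ⊤
  /-- `b = β ^ p` lies in `𝓞_K`, each `c_j` generates the `j`-th ideal associated to `b 𝓞_K`. -/
  exists_pow_eq : ∃ b : 𝓞 K, algebraMap (𝓞 K) (𝓞 L) b = β ^ p ∧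
    ∀ j : Fin p, associatedIdeal p (Ideal.span {b}) j = Ideal.span {c j}
  /-- `∑ β ^ j / c_j ≡ 0 mod p 𝓞_L`. -/
  radicalSum_mem : ∃ y : 𝓞 L, radicalSum p β c = (p : L) * (y : L)

end NumberFields

end HopfGaloisRadical

end

open HopfGaloisRadical

/-! Write e_j for the projection of L onto the line K ω^j. The argument first shows that H must be
the algebra of diagonal operators on the powers of ω, and then computes with lattices in
coordinates.

Rigidity. Let E be a splitting field of X^p - a, and let σ be an automorphism of E of order p; it
fixes the p-th roots of unity and multiplies the image of ω by such a root ζ ≠ 1. For an embedding x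
of L in E, expand x(h·t) = ∑ a_{x,y}(h) y(t) over all embeddings y. The module-algebra axiom makes
the functionals a_{x,y} orthogonal idempotents for convolution (`convolution_actionCoeff`), and
surjectivity of the Galois map makes them independent. They are therefore the p primitive
idempotents of Hom_K(H, E), whatever x is. Thus σ permutes them with π^p = 1, and h = 1 singles out
a fixed point, so π = 1. Hence a_{x,y} = a_{σx,σy}, which forces h·ω^k ∈ K ω^k
(`IsHopfGalois.exists_diagonal`).

Integrality. The elements p e_j(y) = ∑ ζ^{-ij} σ^i(y) are integral for y ∈ 𝓞_L, and they are all
congruent modulo the ideal J of integers divisible by ζ - 1. Since p is unramified, J ∩ 𝓞_K = p𝓞_K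
(`exists_congruenceIdeal`).

Sufficiency. Relative to x = (1/p)∑ β^j/c_j, the coordinates Y_j of an integer are integral because
c_j carries the full p-th power part of b^j, and congruent mod p because of J. So diag(Y_j) = Y_0 +
p(...) lies in 𝔄 and sends x to that integer.

Necessity. Let x be a free generator and let w_j = p e_j(x). The crucial point is that w_j^p ∈ 𝓞_K
has all prime exponents below p (`primeExponent_lt_of_isFreeGenerator`); at primes above p this uses
tameness through the trace. Then β = w_1 and c_j = β^j/w_j form a datum. -/

noncomputable section

namespace HopfGaloisRadical

/-! ### Radical extensions and conjugation by an automorphism of order p -/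

section RadicalExtension

open Polynomial

variable {K L : Type*} [Field K] [Field L] [Algebra K L] {p : ℕ} {β : L} {b : K}

/-- The powers of a generator of an extension of degree `p` form a basis. -/
theorem exists_basis_pow (hp : p.Prime) (hdeg : Module.finrank K L = p)
    (hβ : IntermediateField.adjoin K {β} = ⊤) :
    ∃ B : Module.Basis (Fin p) K L, ∀ j, B j = β ^ (j : ℕ) := by
  have : FiniteDimensional K L := .of_finrank_pos (hdeg ▸ hp.pos)
  have hint : IsIntegral K β := .of_finite K β
  let pb : PowerBasis K L :=
    (IntermediateField.adjoin.powerBasis hint).map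
      ((IntermediateField.equivOfEq hβ).trans IntermediateField.topEquiv)
  have hgen : pb.gen = β := by
    simp [pb]
  have hdim : pb.dim = p := by rw [← pb.finrank, hdeg]
  refine ⟨pb.basis.reindex (finCongr hdim), fun j => ?_⟩
  simp [hgen]

theorem minpoly_eq_X_pow_sub_C (hp : p.Prime) (B : Module.Basis (Fin p) K L)
    (hB : ∀ j, B j = β ^ (j : ℕ)) (hb : β ^ p = algebraMap K L b) :
    minpoly K β = X ^ p - C b := by
  let pb : PowerBasis K L := ⟨β, p, B, hB⟩
  have hint : IsIntegral K β := pb.isIntegral_gen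
  refine (eq_of_monic_of_dvd_of_natDegree_le (minpoly.monic hint)
    (monic_X_pow_sub_C b hp.ne_zero) (minpoly.dvd K β (by simp [hb])) ?_).symm
  rw [natDegree_X_pow_sub_C]
  exact (pb.natDegree_minpoly).ge

/-- An extension `E` of `K` with an embedding of `L` and an automorphism multiplying the
image of `β` by a primitive `p`-th root of unity that it fixes. -/
structure RadicalConjugation (K L E : Type*) [Field K] [Field L] [Field E] [Algebra K L]
    [Algebra K E] (p : ℕ) (β : L) where
  σ : E ≃ₐ[K] E
  ι : L →ₐ[K] E
  ζ : E
  prim : IsPrimitiveRoot ζ p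
  map_zeta : σ ζ = ζ
  map_root : σ (ι β) = ζ * ι β

theorem eq_one_of_pow_prime_modEq {k : ℕ} (hp : p.Prime) (hk : k ^ p ≡ 1 [MOD p]) :
    k ≡ 1 [MOD p] := by
  have : Fact p.Prime := ⟨hp⟩
  rw [← ZMod.natCast_eq_natCast_iff] at hk ⊢
  simpa using hk

/-- An automorphism of order dividing `p` fixes every primitive `p`-th root of unity. -/
theorem map_eq_self_of_pow_eq_one {E : Type*} [Field E] [Algebra K E] (hp : p.Prime)
    (σ : E ≃ₐ[K] E) (hσ : σ ^ p = 1) {ζ : E} (hζ : IsPrimitiveRoot ζ p) : σ ζ = ζ := by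
  have : NeZero p := ⟨hp.ne_zero⟩
  obtain ⟨k, -, hk⟩ := hζ.eq_pow_of_pow_eq_one (ξ := σ ζ) (by rw [← map_pow, hζ.pow_eq_one, map_one])
  have hpow : ∀ n : ℕ, (σ ^ n) ζ = ζ ^ (k ^ n) := by
    intro n
    induction n with
    | zero => simp
    | succ n ih => rw [pow_succ', AlgEquiv.mul_apply, ih, map_pow, ← hk, ← pow_mul, pow_succ']
  have hfin : IsOfFinOrder ζ := isOfFinOrder_iff_pow_eq_one.2 ⟨p, hp.pos, hζ.pow_eq_one⟩
  have h1 : ζ ^ (k ^ p) = ζ ^ 1 := by rw [← hpow, hσ]; simp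
  have h2 : k ≡ 1 [MOD p] := by
    apply eq_one_of_pow_prime_modEq hp
    rwa [hfin.pow_eq_pow_iff_modEq, ← hζ.eq_orderOf] at h1
  rw [← hk]
  conv_rhs => rw [← pow_one ζ]
  rwa [hfin.pow_eq_pow_iff_modEq, ← hζ.eq_orderOf]

/-- Since L embeds in the splitting field, p divides the order of the Galois group, and Cauchy gives
σ of order p. It moves some root r, so σ r / r is a nontrivial, hence primitive, p-th root of unity,
fixed by σ because of the order of σ. The embedding ι is chosen to send β to r. -/
theorem exists_radicalConjugation [CharZero K] (hp : p.Prime) (B : Module.Basis (Fin p) K L)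
    (hB : ∀ j, B j = β ^ (j : ℕ)) (hb : β ^ p = algebraMap K L b) :
    Nonempty (RadicalConjugation K L (X ^ p - C b : K[X]).SplittingField p β) := by
  have hmin := minpoly_eq_X_pow_sub_C hp B hB hb
  let pb : PowerBasis K L := ⟨β, p, B, hB⟩
  have : FiniteDimensional K L := pb.finite
  have hβ0 : β ≠ 0 := by
    have := B.ne_zero ⟨1, hp.one_lt⟩
    simpa [hB] using this
  have hb0 : b ≠ 0 := by
    rintro rfl
    simp [hβ0] at hb
  set f : K[X] := X ^ p - C b with hf
  have hf0 : f ≠ 0 := X_pow_sub_C_ne_zero hp.pos b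
  have : IsGalois K f.SplittingField := {}
  have key : p ∣ Nat.card (f.SplittingField ≃ₐ[K] f.SplittingField) := by
    rw [IsGalois.card_aut_eq_finrank]
    obtain ⟨r, hr⟩ := (SplittingField.splits f).exists_eval_eq_zero (by
      rw [degree_map, hf, degree_X_pow_sub_C hp.pos]; exact_mod_cast hp.ne_zero)
    let ι : L →ₐ[K] f.SplittingField := pb.lift r (by
      change aeval r (minpoly K β) = 0
      rw [hmin, aeval_def, ← eval_map]; exact hr)
    let := ι.toRingHom.toAlgebra
    have : IsScalarTower K L f.SplittingField := .of_algebraMap_eq' ι.comp_algebraMap.symm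
    have h := Module.finrank_mul_finrank K L f.SplittingField
    rw [← h, Module.finrank_eq_card_basis B, Fintype.card_fin]
    exact dvd_mul_right _ _
  have : Fact p.Prime := ⟨hp⟩
  obtain ⟨σ, hσ⟩ := exists_prime_orderOf_dvd_card' p key
  have hσp : σ ^ p = 1 := hσ ▸ pow_orderOf_eq_one σ
  obtain ⟨r, hr, hrσ⟩ : ∃ r : f.SplittingField, aeval r f = 0 ∧ σ r ≠ r := by
    by_contra! h
    have : σ = 1 := by
      have h2 : (σ : f.SplittingField →ₐ[K] f.SplittingField) = AlgHom.id K _ := by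
        apply AlgHom.ext_of_adjoin_eq_top (SplittingField.adjoin_rootSet f)
        intro r hr
        exact h r (aeval_eq_zero_of_mem_rootSet hr)
      exact AlgEquiv.ext fun x => DFunLike.congr_fun h2 x
    rw [this, orderOf_one] at hσ
    exact hp.one_lt.ne hσ
  have hrp : r ^ p = algebraMap K _ b := by
    simpa [hf, sub_eq_zero] using hr
  have hr0 : r ≠ 0 := by
    rintro rfl
    rw [zero_pow hp.ne_zero, eq_comm, map_eq_zero] at hrp
    exact hb0 hrp
  have hζ1 : (σ r / r) ^ p = 1 := by
    rw [div_pow, ← map_pow, hrp, AlgEquiv.commutes, ← hrp, div_self (pow_ne_zero _ hr0)]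
  have hζ : IsPrimitiveRoot (σ r / r) p := by
    rw [← orderOf_eq_prime hζ1 (by rwa [ne_eq, div_eq_one_iff_eq hr0])]
    exact IsPrimitiveRoot.orderOf _
  have hι : aeval r (minpoly K pb.gen) = 0 := by
    change aeval r (minpoly K β) = 0
    rw [hmin, hr]
  have hιβ : pb.lift r hι β = r := pb.lift_gen r hι
  exact ⟨⟨σ, pb.lift r hι, σ r / r, hζ, map_eq_self_of_pow_eq_one hp σ hσp hζ, by
    rw [hιβ, div_mul_cancel₀ _ hr0]⟩⟩

namespace RadicalConjugation

variable {E : Type*} [Field E] [Algebra K E] (R : RadicalConjugation K L E p β)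

include R in
theorem pow_conj_root (i : ℕ) : (R.σ ^ i) (R.ι β) = R.ζ ^ i * R.ι β := by
  induction i with
  | zero => simp
  | succ i ih =>
    rw [pow_succ', AlgEquiv.mul_apply, ih, map_mul, map_pow, R.map_zeta, R.map_root, pow_succ]
    ring

theorem pow_conj_basis (B : Module.Basis (Fin p) K L) (hB : ∀ j, B j = β ^ (j : ℕ)) (i : ℕ)
    (y : L) : (R.σ ^ i) (R.ι y) =
      ∑ j : Fin p, R.ζ ^ (i * (j : ℕ)) * R.ι (B.repr y j • β ^ (j : ℕ)) := by
  conv_lhs => rw [← B.sum_repr y]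
  simp only [map_sum, hB, map_smul, map_pow, R.pow_conj_root, mul_pow, ← pow_mul]
  exact Finset.sum_congr rfl fun j _ => by rw [mul_smul_comm]

/-- The homogeneous components of `y` recovered from its conjugates. -/
theorem sum_conj (hp : p.Prime) (B : Module.Basis (Fin p) K L) (hB : ∀ j, B j = β ^ (j : ℕ))
    (y : L) (j : Fin p) :
    ∑ i ∈ Finset.range p, (R.ζ⁻¹) ^ (i * (j : ℕ)) * (R.σ ^ i) (R.ι y) =
      p * R.ι (B.repr y j • β ^ (j : ℕ)) := by
  have hζ0 : R.ζ ≠ 0 := R.prim.ne_zero hp.ne_zero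
  simp only [R.pow_conj_basis B hB, Finset.mul_sum]
  rw [Finset.sum_comm, Finset.sum_eq_single j]
  · rw [Finset.sum_congr rfl (g := fun _ => R.ι (B.repr y j • β ^ (j : ℕ)))]
    · simp
    · intro i _
      rw [← mul_assoc, ← mul_pow, inv_mul_cancel₀ hζ0, one_pow, one_mul]
  · intro k _ hk
    have h1 : ∀ i : ℕ, R.ζ⁻¹ ^ (i * (j : ℕ)) * (R.ζ ^ (i * (k : ℕ)) *
        R.ι (B.repr y k • β ^ (k : ℕ))) =
        (R.ζ⁻¹ ^ (j : ℕ) * R.ζ ^ (k : ℕ)) ^ i * R.ι (B.repr y k • β ^ (k : ℕ)) := by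
      intro i; ring
    simp only [h1, ← Finset.sum_mul]
    have hne : R.ζ⁻¹ ^ (j : ℕ) * R.ζ ^ (k : ℕ) ≠ 1 := by
      intro h
      rw [inv_pow, inv_mul_eq_one₀ (pow_ne_zero _ hζ0)] at h
      exact hk (Fin.ext (R.prim.pow_inj j.2 k.2 h).symm)
    have hp1 : (R.ζ⁻¹ ^ (j : ℕ) * R.ζ ^ (k : ℕ)) ^ p = 1 := by
      rw [mul_pow, ← pow_mul, ← pow_mul, mul_comm (j : ℕ), mul_comm (k : ℕ), pow_mul, pow_mul,
        inv_pow, R.prim.pow_eq_one]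
      simp
    rw [geom_sum_eq hne, hp1, sub_self, zero_div, zero_mul]
  · simp

end RadicalConjugation

end RadicalExtension

end HopfGaloisRadical

end

noncomputable section

namespace HopfGaloisRadical

/-! ### Coefficients of a Hopf action in the basis of embeddings -/

section Embeddings

variable {K L E : Type*} [Field K] [Field L] [Field E] [Algebra K L] [Algebra K E]
  [FiniteDimensional K L]

/-- If there are `[L : K]` embeddings of `L` into `E`, they form an `E`-basis of
`Hom_K(L, E)`. -/
def embBasis (hcard : Fintype.card (L →ₐ[K] E) = Module.finrank K L) :
    Module.Basis (L →ₐ[K] E) E (L →ₗ[K] E) :=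
  haveI : Nonempty (L →ₐ[K] E) :=
    Fintype.card_pos_iff.1 (hcard ▸ Module.finrank_pos)
  basisOfLinearIndependentOfCardEqFinrank (linearIndependent_toLinearMap K L E)
    (by rw [hcard, Module.finrank_linearMap_self])

variable (hcard : Fintype.card (L →ₐ[K] E) = Module.finrank K L)

theorem embBasis_apply (y : L →ₐ[K] E) : embBasis hcard y = y.toLinearMap := by
  simp [embBasis]

theorem sum_embBasis_repr (f : L →ₗ[K] E) (t : L) :
    f t = ∑ y, (embBasis hcard).repr f y * y t := by
  conv_lhs => rw [← (embBasis hcard).sum_repr f]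
  simp [embBasis_apply]

include hcard in
theorem eq_zero_of_sum_emb_eq_zero {a : (L →ₐ[K] E) → E}
    (h : ∀ t, ∑ y, a y * y t = 0) (y : L →ₐ[K] E) : a y = 0 := by
  refine Fintype.linearIndependent_iff.1 (embBasis hcard).linearIndependent a ?_ y
  ext t
  simpa [embBasis_apply] using h t

variable {H : Type*} [Ring H] [HopfAlgebra K H] [Module H L] [IsScalarTower K H L]

/-- The coefficient at `y` of the functional `t ↦ x (h • t)`, as a function of `h`. -/
def actionCoeff (x y : L →ₐ[K] E) : H →ₗ[K] E where
  toFun h := (embBasis hcard).repr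
    (x.toLinearMap ∘ₗ (Algebra.lsmul K K L h : L →ₗ[K] L)) y
  map_add' a b := by simp [LinearMap.comp_add]
  map_smul' c a := by
    have : x.toLinearMap ∘ₗ (Algebra.lsmul K K L (c • a) : L →ₗ[K] L) =
        algebraMap K E c • (x.toLinearMap ∘ₗ (Algebra.lsmul K K L a : L →ₗ[K] L)) := by
      ext t; simp [Algebra.smul_def]
    rw [this, map_smul, Finsupp.smul_apply, RingHom.id_apply, smul_eq_mul, Algebra.smul_def]

theorem emb_smul (x : L →ₐ[K] E) (h : H) (t : L) :
    x (h • t) = ∑ y, actionCoeff hcard x y h * y t :=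
  sum_embBasis_repr hcard (x.toLinearMap ∘ₗ (Algebra.lsmul K K L h : L →ₗ[K] L)) t

theorem actionCoeff_unique {x : L →ₐ[K] E} {h : H} {a : (L →ₐ[K] E) → E}
    (ha : ∀ t, x (h • t) = ∑ y, a y * y t) (y : L →ₐ[K] E) : actionCoeff hcard x y h = a y := by
  rw [← sub_eq_zero]
  refine eq_zero_of_sum_emb_eq_zero hcard (a := fun y => actionCoeff hcard x y h - a y) ?_ y
  intro t
  simp only [sub_mul, Finset.sum_sub_distrib, ← emb_smul, ← ha, sub_self]

theorem actionCoeff_one [DecidableEq (L →ₐ[K] E)] (x y : L →ₐ[K] E) :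
    actionCoeff hcard x y (1 : H) = if y = x then 1 else 0 := by
  refine actionCoeff_unique hcard (a := fun y => if y = x then 1 else 0) (fun t => ?_) y
  simp

theorem actionCoeff_conj (σ : E ≃ₐ[K] E) (x y : L →ₐ[K] E) (h : H) :
    actionCoeff hcard (σ.toAlgHom.comp x) (σ.toAlgHom.comp y) h = σ (actionCoeff hcard x y h) := by
  let e : (L →ₐ[K] E) ≃ (L →ₐ[K] E) :=
    { toFun := fun y => σ.toAlgHom.comp y
      invFun := fun y => σ.symm.toAlgHom.comp y
      left_inv := fun y => by ext; simp
      right_inv := fun y => by ext; simp }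
  have := actionCoeff_unique hcard (x := σ.toAlgHom.comp x) (h := h)
    (a := fun y => σ (actionCoeff hcard x (e.symm y) h)) (fun t => ?_) (e y)
  · rwa [e.symm_apply_apply] at this
  · rw [← e.sum_comp]
    simp only [Equiv.symm_apply_apply]
    simp [e, emb_smul hcard x h t]

/-- Convolution of functionals on a coalgebra. -/
def convolution (f g : H →ₗ[K] E) : H →ₗ[K] E :=
  LinearMap.mul' K E ∘ₗ TensorProduct.map f g ∘ₗ Coalgebra.comul

omit [FiniteDimensional K L] [Module H L] in
theorem mul'_map_sum_smul {ι κ : Type*} [Fintype ι] [Fintype κ] (a : ι → E) (b : κ → E)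
    (f : ι → H →ₗ[K] E) (g : κ → H →ₗ[K] E) (w : H ⊗[K] H) :
    LinearMap.mul' K E (TensorProduct.map (∑ i, a i • f i) (∑ k, b k • g k) w) =
      ∑ i, ∑ k, a i * b k * LinearMap.mul' K E (TensorProduct.map (f i) (g k) w) := by
  induction w using TensorProduct.induction_on with
  | zero => simp
  | tmul u v =>
    simp only [TensorProduct.map_tmul, LinearMap.mul'_apply, LinearMap.sum_apply,
      LinearMap.smul_apply, smul_eq_mul, Finset.sum_mul_sum]
    exact Finset.sum_congr rfl fun i _ => Finset.sum_congr rfl fun k _ => by ring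
  | add u v hu hv =>
    simp only [map_add, hu, hv, mul_add, Finset.sum_add_distrib]

theorem convolution_sum_smul {ι κ : Type*} [Fintype ι] [Fintype κ] (a : ι → E) (b : κ → E)
    (f : ι → H →ₗ[K] E) (g : κ → H →ₗ[K] E) :
    convolution (∑ i, a i • f i) (∑ k, b k • g k) =
      ∑ i, ∑ k, (a i * b k) • convolution (f i) (g k) := by
  ext h
  simp [convolution, mul'_map_sum_smul]

theorem emb_comp_orbitMap (x : L →ₐ[K] E) (t : L) :
    x.toLinearMap ∘ₗ orbitMap K L H t = ∑ y : L →ₐ[K] E, y t • actionCoeff hcard x y := by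
  ext h
  simp [orbitMap, emb_smul hcard x h t, mul_comm]

/-- Expanding x(h·(tu)) by the module-algebra axiom gives the double sum of y(t) z(u) weighted by
convolutions; expanding it directly leaves only the diagonal y = z, since y(tu) = y(t) y(u).
Independence of the embeddings, in t and then in u, compares coefficients. -/
theorem convolution_actionCoeff [DecidableEq (L →ₐ[K] E)] (hH : IsHopfGalois K L H)
    (x y z : L →ₐ[K] E) :
    convolution (actionCoeff hcard x y : H →ₗ[K] E) (actionCoeff hcard x z) =
      if y = z then actionCoeff hcard x y else 0 := by
  ext h
  have key : ∀ t u : L, ∑ y : L →ₐ[K] E, (∑ z : L →ₐ[K] E,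
      (convolution (actionCoeff hcard x y) (actionCoeff hcard x z) h -
        if y = z then actionCoeff hcard x y h else 0) * z u) * y t = 0 := by
    intro t u
    have h1 : x (h • (t * u)) = ∑ y : L →ₐ[K] E, ∑ z : L →ₐ[K] E,
        y t * z u * convolution (actionCoeff hcard x y) (actionCoeff hcard x z) h := by
      rw [hH.smul_mul]
      have h2 : ∀ w : L ⊗[K] L, x (LinearMap.mul' K L w) =
          LinearMap.mul' K E (TensorProduct.map x.toLinearMap x.toLinearMap w) := by
        intro w
        induction w using TensorProduct.induction_on with
        | zero => simp
        | tmul u v => simp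
        | add u v hu hv => simp only [map_add, hu, hv]
      rw [h2, ← LinearMap.comp_apply (TensorProduct.map _ _), ← TensorProduct.map_comp, emb_comp_orbitMap hcard,
        emb_comp_orbitMap hcard, mul'_map_sum_smul]
      rfl
    rw [emb_smul hcard] at h1
    have h3 : ∑ y : L →ₐ[K] E, ∑ z : L →ₐ[K] E,
        y t * z u * (if y = z then actionCoeff hcard x y h else 0) =
        ∑ y : L →ₐ[K] E, actionCoeff hcard x y h * y (t * u) := by
      refine Finset.sum_congr rfl fun y _ => ?_
      simp only [mul_ite, mul_zero, Finset.sum_ite_eq, Finset.mem_univ, if_true, map_mul]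
      ring
    rw [← sub_eq_zero, ← h3, ← Finset.sum_sub_distrib] at h1
    rw [← neg_eq_zero, ← Finset.sum_neg_distrib]
    refine Eq.trans ?_ h1
    refine Finset.sum_congr rfl fun y _ => ?_
    rw [Finset.sum_mul, ← Finset.sum_neg_distrib, ← Finset.sum_sub_distrib]
    exact Finset.sum_congr rfl fun z _ => by ring
  have := eq_zero_of_sum_emb_eq_zero hcard (fun u =>
    eq_zero_of_sum_emb_eq_zero hcard (fun t => key t u) y) z
  rw [sub_eq_zero] at this
  rw [this]
  split_ifs <;> rfl

/-- A relation is an E-linear form Φ on Hom_K(L, E) that kills every x ∘ h. By surjectivity of the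
Galois map it kills x ∘ T for every endomorphism T, and those with T of rank one already span
Hom_K(L, E) over E. -/
theorem linearIndependent_actionCoeff (hH : IsHopfGalois K L H) (x : L →ₐ[K] E) :
    LinearIndependent E (fun y => (actionCoeff hcard x y : H →ₗ[K] E)) := by
  rw [Fintype.linearIndependent_iff]
  intro a ha
  let Φ : (L →ₗ[K] E) →ₗ[E] E := ∑ y, a y • (embBasis hcard).coord y
  have hact : ∀ h : H, Φ (x.toLinearMap ∘ₗ (Algebra.lsmul K K L h : L →ₗ[K] L)) = 0 := by
    intro h
    have := LinearMap.congr_fun ha h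
    simpa [Φ, actionCoeff] using this
  have hend : ∀ T : Module.End K L, Φ (x.toLinearMap ∘ₗ T) = 0 := by
    intro T
    obtain ⟨w, rfl⟩ := hH.bijective.2 T
    induction w using TensorProduct.induction_on with
    | zero => simp
    | tmul s h =>
      have : x.toLinearMap ∘ₗ galoisMap K L H (s ⊗ₜ h) =
          x s • (x.toLinearMap ∘ₗ (Algebra.lsmul K K L h : L →ₗ[K] L)) := by
        ext t; simp [galoisMap]
      rw [this, map_smul, hact, smul_zero]
    | add u v hu hv => rw [map_add, LinearMap.comp_add, map_add, hu, hv, add_zero]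
  have hall : ∀ f : L →ₗ[K] E, Φ f = 0 := by
    intro f
    let c := Module.finBasis K L
    have : f = ∑ i, f (c i) • (x.toLinearMap ∘ₗ (LinearMap.toSpanSingleton K L 1 ∘ₗ c.coord i)) := by
      refine c.ext fun k => ?_
      simp [Finsupp.single_apply, apply_ite x, Algebra.smul_def]
    rw [this, map_sum]
    exact Finset.sum_eq_zero fun i _ => by rw [map_smul, hend, smul_zero]
  intro y
  classical
  simpa [Φ, Finsupp.single_apply] using hall (embBasis hcard y)

end Embeddings

end HopfGaloisRadical

end

noncomputable section

namespace HopfGaloisRadical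

/-! ### Rigidity: every Hopf–Galois structure acts diagonally -/

section Diagonal

variable {K L E : Type*} [Field K] [Field L] [Field E] [Algebra K L] [Algebra K E]
  [FiniteDimensional K L]
  {H : Type*} [Ring H] [HopfAlgebra K H] [Module H L] [IsScalarTower K H L]

omit [FiniteDimensional K L] in
theorem IsHopfGalois.lsmul_injective (hH : IsHopfGalois K L H) :
    Function.Injective (Algebra.lsmul K K L : H →ₐ[K] Module.End K L) := by
  intro h h' e
  have h1 : galoisMap K L H (1 ⊗ₜ h) = galoisMap K L H (1 ⊗ₜ h') := by
    ext t
    simpa [galoisMap] using LinearMap.congr_fun e t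
  have h2 := hH.bijective.1 h1
  exact Module.FaithfullyFlat.tensorProduct_mk_injective (A := K) (B := L) H h2

theorem IsHopfGalois.finite (hH : IsHopfGalois K L H) : FiniteDimensional K H :=
  FiniteDimensional.of_injective (Algebra.lsmul K K L : H →ₐ[K] Module.End K L).toLinearMap
    hH.lsmul_injective

theorem IsHopfGalois.finrank_eq (hH : IsHopfGalois K L H) :
    Module.finrank K H = Module.finrank K L := by
  have := (LinearEquiv.ofBijective _ hH.bijective).finrank_eq
  rw [Module.finrank_tensorProduct, Module.finrank_linearMap] at this
  exact Nat.eq_of_mul_eq_mul_left Module.finrank_pos this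

variable (hcard : Fintype.card (L →ₐ[K] E) = Module.finrank K L)

/-- The families of coefficients at `x` and at `x'` coincide up to order: both consist of
the primitive idempotents of the convolution algebra. -/
theorem exists_actionCoeff_eq (hH : IsHopfGalois K L H) (x x' : L →ₐ[K] E) :
    ∃ f : (L →ₐ[K] E) → (L →ₐ[K] E), Function.Injective f ∧
      ∀ y, (actionCoeff hcard x y : H →ₗ[K] E) = actionCoeff hcard x' (f y) := by
  classical
  have := hH.finite
  have : Nonempty (L →ₐ[K] E) := ⟨x⟩
  let D : Module.Basis (L →ₐ[K] E) E (H →ₗ[K] E) :=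
    basisOfLinearIndependentOfCardEqFinrank (linearIndependent_actionCoeff hcard hH x')
      (by rw [hcard, Module.finrank_linearMap_self, hH.finrank_eq])
  have hD : ∀ y, D y = actionCoeff hcard x' y := fun y => by simp [D]
  have hDconv : ∀ y z, convolution (D y) (D z) = if y = z then D y else 0 := by
    intro y z
    rw [hD, hD, convolution_actionCoeff hcard hH]
  have hexp : ∀ f g : H →ₗ[K] E, convolution f g = ∑ z, (D.repr f z * D.repr g z) • D z := by
    intro f g
    conv_lhs => rw [← D.sum_repr f, ← D.sum_repr g]
    rw [convolution_sum_smul]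
    refine Finset.sum_congr rfl fun y _ => ?_
    simp [hDconv]
  have hmul : ∀ f g : H →ₗ[K] E, ∀ z, D.repr (convolution f g) z = D.repr f z * D.repr g z := by
    intro f g z
    rw [hexp, D.repr_sum_self]
  -- In the basis `D` convolution is coordinatewise multiplication, so idempotents have coordinates
  -- 0 or 1 and orthogonal ones have disjoint supports. As many nonempty disjoint supports as points
  -- must be singletons.
  have hidem : ∀ y z, D.repr (actionCoeff hcard x y) z = 0 ∨
      D.repr (actionCoeff hcard x y) z = 1 := by
    intro y z
    have h1 := hmul (actionCoeff hcard x y) (actionCoeff hcard x y) z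
    rw [convolution_actionCoeff hcard hH, if_pos rfl] at h1
    have h2 : D.repr (actionCoeff hcard x y) z * (D.repr (actionCoeff hcard x y) z - 1) = 0 := by
      rw [mul_sub, mul_one, ← h1, sub_self]
    rcases mul_eq_zero.1 h2 with h | h
    · exact .inl h
    · exact .inr (sub_eq_zero.1 h)
  have hdisj : ∀ y y' z, D.repr (actionCoeff hcard x y) z ≠ 0 →
      D.repr (actionCoeff hcard x y') z ≠ 0 → y = y' := by
    intro y y' z h h'
    by_contra hne
    have h1 := hmul (actionCoeff hcard x y) (actionCoeff hcard x y') z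
    rw [convolution_actionCoeff hcard hH, if_neg hne] at h1
    exact mul_ne_zero h h' (by rw [← h1]; simp)
  have hne : ∀ y, ∃ z, D.repr (actionCoeff hcard x y) z ≠ 0 := by
    intro y
    by_contra! h
    refine (linearIndependent_actionCoeff hcard hH x).ne_zero y ?_
    exact D.repr.map_eq_zero_iff.1 (Finsupp.ext h)
  choose f hf using hne
  have hinj : Function.Injective f := fun y y' e => hdisj y y' (f y) (hf y) (e ▸ hf y')
  refine ⟨f, hinj, fun y => ?_⟩
  rw [← hD, ← D.sum_repr (actionCoeff hcard x y), Finset.sum_eq_single (f y)]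
  · rw [(hidem y (f y)).resolve_left (hf y), one_smul]
  · intro z _ hz
    obtain ⟨y', rfl⟩ := (Finite.injective_iff_surjective.1 hinj) z
    by_contra h
    refine hz (congrArg f (hdisj y' y (f y') (hf y') ?_))
    intro h0
    rw [h0, zero_smul] at h
    exact h rfl
  · simp

/-- The number of fixed points is congruent to |X| = p modulo p, and it is positive, so it is p. -/
theorem eq_id_of_iterate_eq_id {X : Type*} [Fintype X] {p : ℕ} (hp : p.Prime)
    (hX : Fintype.card X = p) {f : X → X} (hf : f^[p] = id) {x : X} (hx : f x = x) : f = id := by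
  classical
  have : Fact p.Prime := ⟨hp⟩
  let F : Function.End X := f
  have hF : F ^ p ^ 1 = 1 := by
    rw [pow_one]
    have : ∀ n : ℕ, F ^ n = (f^[n] : X → X) := by
      intro n
      induction n with
      | zero => rfl
      | succ n ih => rw [pow_succ, Function.iterate_succ, ih]; rfl
    rw [this, hf]; rfl
  have h1 := Equiv.Perm.card_fixedPoints_modEq hF
  rw [hX] at h1
  have h2 : p ∣ Fintype.card (Function.fixedPoints F) :=
    (Nat.modEq_zero_iff_dvd.1 (h1.symm.trans (Nat.modEq_zero_iff_dvd.2 dvd_rfl)))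
  have h3 : 0 < Fintype.card (Function.fixedPoints F) := Fintype.card_pos_iff.2 ⟨⟨x, hx⟩⟩
  have h4 := Nat.le_of_dvd h3 h2
  have h5 : Function.fixedPoints F = Set.univ := by
    apply Set.eq_univ_of_univ_subset
    intro y _
    by_contra hy
    have := Fintype.card_subtype_lt (p := fun y => y ∈ Function.fixedPoints F) hy
    rw [hX] at this
    exact absurd h4 (not_le.2 this)
  funext y
  exact (Set.eq_univ_iff_forall.1 h5 y)

/-- Applying σ to the coefficients at x permutes them by some π with π^p = 1. Evaluation at 1 ∈ H is
nonzero only on the coefficient indexed by x itself, so π fixes x; having a fixed point among p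
indices, π is trivial. -/
theorem actionCoeff_conj_eq {p : ℕ} (hp : p.Prime) (hp' : Module.finrank K L = p)
    (hH : IsHopfGalois K L H) (σ : E ≃ₐ[K] E)
    (hσ : ∀ y : L →ₐ[K] E, (σ ^ p).toAlgHom.comp y = y) (x y : L →ₐ[K] E) (h : H) :
    actionCoeff hcard (σ.toAlgHom.comp x) (σ.toAlgHom.comp y) h = actionCoeff hcard x y h := by
  classical
  obtain ⟨f, hf, hfeq⟩ := exists_actionCoeff_eq hcard hH (σ.toAlgHom.comp x) x
  let π : (L →ₐ[K] E) → (L →ₐ[K] E) := fun y => f (σ.toAlgHom.comp y)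
  have hπ : ∀ y h, (σ (actionCoeff hcard x y h) : E) = actionCoeff hcard x (π y) (h : H) := by
    intro y h
    rw [← actionCoeff_conj, hfeq]
  have hπn : ∀ n y h, ((σ ^ n) (actionCoeff hcard x y h) : E) =
      actionCoeff hcard x (π^[n] y) (h : H) := by
    intro n
    induction n with
    | zero => simp
    | succ n ih => intro y h; rw [pow_succ, AlgEquiv.mul_apply, hπ, ih, Function.iterate_succ_apply]
  have hinj : ∀ y z, (∀ h : H, actionCoeff hcard x y h = actionCoeff hcard x z h) → y = z := by
    intro y z e
    exact (linearIndependent_actionCoeff hcard hH x).injective (LinearMap.ext e)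
  have h1 : π^[p] = id := by
    funext y
    refine hinj _ _ fun h => ?_
    rw [← hπn, ← actionCoeff_conj, hσ, hσ]
    rfl
  have h2 : π x = x := by
    have := hπ x 1
    rw [actionCoeff_one, actionCoeff_one, if_pos rfl, map_one] at this
    by_contra hne
    rw [if_neg hne] at this
    exact one_ne_zero this
  have h3 := eq_id_of_iterate_eq_id hp (hcard.trans hp') h1 h2
  rw [actionCoeff_conj, hπ, h3]
  rfl

variable {p : ℕ} {β : L} {b : K}

theorem RadicalConjugation.card_algHom (R : RadicalConjugation K L E p β) (hβ : β ≠ 0)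
    (hp' : Module.finrank K L = p) :
    Fintype.card (L →ₐ[K] E) = Module.finrank K L := by
  refine le_antisymm ?_ ?_
  · have := (linearIndependent_toLinearMap K L E).fintype_card_le_finrank
    rwa [Module.finrank_linearMap_self] at this
  · rw [hp', ← Fintype.card_fin p]
    refine Fintype.card_le_of_injective (fun i : Fin p => (R.σ ^ (i : ℕ)).toAlgHom.comp R.ι) ?_
    intro i j e
    have := DFunLike.congr_fun e β
    simp only [AlgHom.comp_apply] at this
    have h2 : (R.σ ^ (i : ℕ)) (R.ι β) = (R.σ ^ (j : ℕ)) (R.ι β) := this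
    rw [R.pow_conj_root, R.pow_conj_root] at h2
    have h3 := mul_right_cancel₀ ((map_ne_zero R.ι).2 hβ) h2
    exact Fin.ext (R.prim.pow_inj i.2 j.2 h3)

variable [CharZero K]

/-- In any Hopf-Galois structure on `K(β)/K`, with `β ^ p ∈ K`, the Hopf algebra acts
diagonally with respect to the powers of `β`. -/
theorem IsHopfGalois.exists_smul_pow_eq (hp : p.Prime) (B : Module.Basis (Fin p) K L)
    (hB : ∀ j, B j = β ^ (j : ℕ)) (hb : β ^ p = algebraMap K L b) (hH : IsHopfGalois K L H)
    (h : H) (k : ℕ) : ∃ a : K, h • β ^ k = a • β ^ k := by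
  obtain ⟨R⟩ := exists_radicalConjugation hp B hB hb
  have hp' : Module.finrank K L = p := by rw [Module.finrank_eq_card_basis B, Fintype.card_fin]
  have hβ0 : β ≠ 0 := by
    have := B.ne_zero ⟨1, hp.one_lt⟩
    simpa [hB] using this
  have hcard := R.card_algHom hβ0 hp'
  have : NeZero p := ⟨hp.ne_zero⟩
  have hι0 : R.ι β ≠ 0 := (map_ne_zero R.ι).2 hβ0
  have hroot : ∀ y : L →ₐ[K] _, ∃ i : ℕ, y β = R.ζ ^ i * R.ι β := by
    intro y
    obtain ⟨i, -, hi⟩ := R.prim.eq_pow_of_pow_eq_one (ξ := y β / R.ι β) (by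
      rw [div_pow, ← map_pow, ← map_pow, hb, AlgHom.commutes, AlgHom.commutes, div_self]
      rw [ne_eq, ← AlgHom.commutes R.ι, ← hb, map_pow]
      exact pow_ne_zero _ hι0)
    exact ⟨i, by rw [hi, div_mul_cancel₀ _ hι0]⟩
  have hσβ : ∀ y : L →ₐ[K] _, R.σ (y β) = R.ζ * y β := by
    intro y
    obtain ⟨i, hi⟩ := hroot y
    rw [hi, map_mul, map_pow, R.map_zeta, R.map_root]
    ring
  let pb : PowerBasis K L := ⟨β, p, B, hB⟩
  have hσp : ∀ y : L →ₐ[K] _, (R.σ ^ p).toAlgHom.comp y = y := by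
    intro y
    refine pb.algHom_ext ?_
    have : ∀ n : ℕ, (R.σ ^ n) (y β) = R.ζ ^ n * y β := by
      intro n
      induction n with
      | zero => simp
      | succ n ih =>
        rw [pow_succ', AlgEquiv.mul_apply, ih, map_mul, map_pow, R.map_zeta, hσβ, pow_succ]
        ring
    change (R.σ ^ p) (y β) = y β
    rw [this, R.prim.pow_eq_one, one_mul]
  -- The coefficients are fixed by σ, while every embedding's value at β is multiplied by ζ; this
  -- holds term by term.
  have hfix : R.σ (R.ι (h • β ^ k)) = R.ζ ^ k * R.ι (h • β ^ k) := by
    rw [emb_smul hcard, map_sum, Finset.mul_sum]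
    refine Finset.sum_congr rfl fun y _ => ?_
    rw [map_mul, ← actionCoeff_conj, actionCoeff_conj_eq hcard hp hp' hH R.σ hσp, map_pow,
      map_pow, hσβ, mul_pow]
    ring
  let u : L := h • β ^ k / β ^ k
  have hu : R.σ (R.ι u) = R.ι u := by
    simp only [u, map_div₀, map_pow, hfix, R.map_root, mul_pow]
    exact mul_div_mul_left _ _ (pow_ne_zero _ (R.prim.ne_zero hp.ne_zero))
  have hun : ∀ i : ℕ, (R.σ ^ i) (R.ι u) = R.ι u := by
    intro i
    induction i with
    | zero => simp
    | succ i ih => rw [pow_succ', AlgEquiv.mul_apply, ih, hu]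
  -- At index 0 the formula sums p equal conjugates of u, so u equals its own constant component and
  -- lies in K.
  have hsum := R.sum_conj hp B hB u 0
  simp only [Fin.val_zero, mul_zero, pow_zero, one_mul, hun, Finset.sum_const, Finset.card_range,
    nsmul_eq_mul] at hsum
  have : CharZero (Polynomial.X ^ p - Polynomial.C b : Polynomial K).SplittingField :=
    charZero_of_injective_algebraMap (algebraMap K _).injective
  have hu0 := R.ι.injective (mul_left_cancel₀ (Nat.cast_ne_zero.2 hp.ne_zero) hsum)
  refine ⟨B.repr u 0, ?_⟩
  rw [← div_mul_cancel₀ (h • β ^ k) (pow_ne_zero k hβ0)]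
  change u * _ = _
  conv_lhs => rw [hu0]
  simp

/-- A Hopf-Galois structure on `K(β)/K` identifies its Hopf algebra with the algebra of all
operators that are diagonal with respect to the powers of `β`. -/
theorem IsHopfGalois.exists_diagonal (hp : p.Prime) (B : Module.Basis (Fin p) K L)
    (hB : ∀ j, B j = β ^ (j : ℕ)) (hb : β ^ p = algebraMap K L b) (hH : IsHopfGalois K L H) :
    ∃ χ : H ≃ₗ[K] (Fin p → K), ∀ h j, h • B j = χ h j • B j := by
  choose a ha using fun (h : H) (j : Fin p) => hH.exists_smul_pow_eq hp B hB hb h j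
  simp only [← hB] at ha
  have hav : ∀ h j, a h j = B.repr (h • B j) j := by
    intro h j
    rw [ha]
    simp
  let χ : H →ₗ[K] (Fin p → K) :=
    { toFun := fun h j => B.repr (h • B j) j
      map_add' := fun h h' => by ext j; simp [add_smul]
      map_smul' := fun c h => by ext j; simp }
  have hχ : ∀ h j, h • B j = χ h j • B j := fun h j => by
    rw [ha, hav]; simp [χ, ha]
  have hinj : Function.Injective χ := by
    intro h h' e
    refine hH.lsmul_injective (B.ext fun j => ?_)
    simp only [Algebra.lsmul_coe, hχ, e]
  have := hH.finite
  refine ⟨LinearMap.linearEquivOfInjective χ hinj ?_, fun h j => hχ h j⟩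
  rw [hH.finrank_eq, Module.finrank_eq_card_basis B, Module.finrank_fintype_fun_eq_card]

end Diagonal

end HopfGaloisRadical

end

noncomputable section

namespace HopfGaloisRadical

/-! ### Unramified primes: p generates a squarefree ideal -/

section Unramified

variable {K : Type*} [Field K] [NumberField K] {p : ℕ}

open UniqueFactorizationMonoid in
theorem IsUnramifiedIn.squarefree_span (hp : p.Prime) (hunr : IsUnramifiedIn K p) :
    Squarefree (Ideal.span {(p : 𝓞 K)}) := by
  classical
  have hp0 : (p : 𝓞 K) ≠ 0 := Nat.cast_ne_zero.2 hp.ne_zero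
  have h0 : Ideal.span {(p : 𝓞 K)} ≠ 0 := by simpa using hp0
  have hmap : (Ideal.span {(p : ℤ)}).map (algebraMap ℤ (𝓞 K)) = Ideal.span {(p : 𝓞 K)} := by
    simp [Ideal.map_span]
  rw [squarefree_iff_nodup_normalizedFactors h0, Multiset.nodup_iff_count_le_one]
  intro P
  by_cases hP : P ∈ normalizedFactors (Ideal.span {(p : 𝓞 K)})
  · have hprime : P.IsPrime := Ideal.isPrime_of_prime (prime_of_normalized_factor P hP)
    have hmem : (p : 𝓞 K) ∈ P := by
      have := Ideal.dvd_iff_le.1 (dvd_of_mem_normalizedFactors hP)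
      exact this (Ideal.mem_span_singleton_self _)
    have hmax : (Ideal.span {(p : ℤ)}).IsMaximal :=
      PrincipalIdealRing.isMaximal_of_irreducible (Nat.prime_iff_prime_int.1 hp).irreducible
    have : P.LiesOver (Ideal.span {(p : ℤ)}) := by
      constructor
      refine hmax.eq_of_le (Ideal.IsPrime.under ℤ P).ne_top ?_
      rw [Ideal.span_singleton_le_iff_mem, Ideal.mem_comap]
      simpa using hmem
    have := Ideal.IsDedekindDomain.ramificationIdx_eq_normalizedFactors_count
      (Ideal.span {(p : ℤ)}) P (by rwa [hmap])
    rw [hmap, hunr P hprime hmem] at this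
    exact this.symm.le
  · rw [Multiset.count_eq_zero.2 hP]
    exact zero_le_one

theorem IsUnramifiedIn.dvd_of_dvd_pow (hp : p.Prime) (hunr : IsUnramifiedIn K p) {u : 𝓞 K} {n : ℕ}
    (h : (p : 𝓞 K) ∣ u ^ n) : (p : 𝓞 K) ∣ u := by
  have := (hunr.squarefree_span hp).isRadical n (Ideal.span {u}) (by
    rw [Ideal.span_singleton_pow, Ideal.dvd_span_singleton, Ideal.mem_span_singleton]
    exact h)
  rwa [Ideal.dvd_span_singleton, Ideal.mem_span_singleton] at this

theorem IsUnramifiedIn.notMem_sq (hp : p.Prime) (hunr : IsUnramifiedIn K p) {P : Ideal (𝓞 K)}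
    (hP : P.IsPrime) : (p : 𝓞 K) ∉ P ^ 2 := by
  intro h
  have := hunr.squarefree_span hp P (by
    rw [Ideal.dvd_span_singleton, ← sq]
    exact h)
  exact hP.ne_top (Ideal.isUnit_iff.1 this)

end Unramified

/-! ### Divisibility between ζ - 1 and p -/

section PrimitiveRoot

variable {E : Type*} [Field E] {p : ℕ} {ζ : E}

theorem isIntegral_of_pow_prime_eq_one (hp : p.Prime) (h : ζ ^ p = 1) : IsIntegral ℤ ζ :=
  .of_pow hp.pos (h ▸ isIntegral_one)

theorem isIntegral_pow_sub_one_div (hp : p.Prime) (h : ζ ^ p = 1) (h1 : ζ ≠ 1) (m : ℕ) :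
    IsIntegral ℤ ((ζ ^ m - 1) / (ζ - 1)) := by
  rw [← geom_sum_eq h1]
  exact IsIntegral.sum _ fun i _ => (isIntegral_of_pow_prime_eq_one hp h).pow i

/-- `(ζ - 1) ^ (p - 1) / p` is integral. -/
theorem isIntegral_sub_one_pow_div [CharZero E] (hp : p.Prime) (hζ : IsPrimitiveRoot ζ p) :
    IsIntegral ℤ ((ζ - 1) ^ (p - 1) / (p : E)) := by
  obtain ⟨n, rfl⟩ : ∃ n, p = n + 1 := ⟨p - 1, (Nat.sub_add_cancel hp.one_le).symm⟩
  have hprod := hζ.prod_one_sub_pow_eq_order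
  rw [Nat.add_sub_cancel, Nat.cast_add, Nat.cast_one, ← hprod,
    ← Finset.card_range n, ← Finset.prod_const, Finset.card_range, ← Finset.prod_div_distrib]
  refine IsIntegral.prod _ fun i hi => ?_
  have hi : i < n := Finset.mem_range.1 hi
  have hcop : Nat.Coprime (i + 1) (n + 1) :=
    (Nat.coprime_of_lt_prime (by omega) (by omega) hp).symm
  -- ζ is itself a power of ζ^(i+1), so (ζ - 1)/(ζ^(i+1) - 1) is a geometric sum in ζ^(i+1).
  have hprim : IsPrimitiveRoot (ζ ^ (i + 1)) (n + 1) := hζ.pow_of_coprime _ hcop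
  have : NeZero (n + 1) := ⟨by omega⟩
  obtain ⟨m, -, hm⟩ := hprim.eq_pow_of_pow_eq_one hζ.pow_eq_one
  have := isIntegral_pow_sub_one_div hp hprim.pow_eq_one (hprim.ne_one hp.one_lt) m
  rw [hm] at this
  rw [← neg_sub (ζ ^ (i + 1)), div_neg]
  exact this.neg

end PrimitiveRoot

/-! ### Homogeneous components of integers and congruences modulo ζ - 1 -/

section CongruenceIdeal

variable {K L : Type*} [Field K] [Field L] [NumberField K] [NumberField L] [Algebra K L]
  {p : ℕ} {β : L} {b : K}

omit [NumberField K] in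
theorem exists_coe_eq_of_isIntegral {x : K} (h : IsIntegral ℤ x) : ∃ z : 𝓞 K, (z : K) = x :=
  ⟨⟨x, h⟩, rfl⟩

omit [NumberField K] [NumberField L] in
theorem isIntegral_map_iff {E : Type*} [Field E] [Algebra K E] (f : L →ₐ[K] E) {x : L} :
    IsIntegral ℤ (f x) ↔ IsIntegral ℤ x :=
  isIntegral_algHom_iff ((f : L →+* E).toIntAlgHom) f.injective

namespace RadicalConjugation

variable {E : Type*} [Field E] [Algebra K E] (R : RadicalConjugation K L E p β)

/-- The integers of `L` that become divisible by `ζ - 1`. -/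
def congruenceIdeal : Ideal (𝓞 L) where
  carrier := {y | ∃ w : E, IsIntegral ℤ w ∧ R.ι y = (R.ζ - 1) * w}
  zero_mem' := ⟨0, isIntegral_zero, by simp⟩
  add_mem' := by
    rintro x y ⟨w, hw, hx⟩ ⟨w', hw', hy⟩
    exact ⟨w + w', hw.add hw', by
      change R.ι ((x : L) + (y : L)) = _
      rw [map_add, hx, hy, mul_add]⟩
  smul_mem' := by
    rintro a x ⟨w, hw, hx⟩
    refine ⟨R.ι a * w, ((isIntegral_map_iff R.ι).2 a.isIntegral_coe).mul hw, ?_⟩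
    change R.ι ((a : L) * (x : L)) = _
    rw [map_mul, hx]
    ring

-- The factor 1 - ζ is split off from p = ∏ (1 - ζ^k), 0 < k < p.
omit [NumberField K] [NumberField L] in
theorem natCast_mem_congruenceIdeal (hp : p.Prime) : (p : 𝓞 L) ∈ R.congruenceIdeal := by
  have hone : R.ζ - 1 ≠ 0 := sub_ne_zero.2 (R.prim.ne_one hp.one_lt)
  obtain ⟨n, rfl⟩ : ∃ n, p = n + 2 := ⟨p - 2, (Nat.sub_add_cancel hp.two_le).symm⟩
  have hprod := R.prim.prod_one_sub_pow_eq_order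
  rw [Finset.prod_range_succ', zero_add, pow_one] at hprod
  refine ⟨-∏ k ∈ Finset.range n, (1 - R.ζ ^ (k + 1 + 1)), ?_, ?_⟩
  · exact (IsIntegral.prod _ fun i _ => isIntegral_one.sub
      ((isIntegral_of_pow_prime_eq_one hp R.prim.pow_eq_one).pow _)).neg
  · push_cast
    simp only [map_add, map_natCast, map_ofNat]
    push_cast at hprod
    linear_combination -hprod

-- If ζ - 1 divides u, then (ζ - 1)^(p-1), an integral multiple of p, divides u^(p-1); the quotient
-- lies in K, so integrality descends. The unramifiedness of p later removes the exponent.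
omit [NumberField L] in
theorem dvd_pow_of_mem_congruenceIdeal (hp : p.Prime) {u : 𝓞 K}
    (hu : algebraMap (𝓞 K) (𝓞 L) u ∈ R.congruenceIdeal) : (p : 𝓞 K) ∣ u ^ (p - 1) := by
  obtain ⟨w, hw, h⟩ := hu
  have : CharZero E := charZero_of_injective_algebraMap (algebraMap K E).injective
  have hp0 : (p : E) ≠ 0 := Nat.cast_ne_zero.2 hp.ne_zero
  have h' : algebraMap K E (u : K) = (R.ζ - 1) * w := by
    rw [← h, ← AlgHom.commutes R.ι]
    rfl
  have hint : IsIntegral ℤ (algebraMap K E ((u : K) ^ (p - 1) / (p : K))) := by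
    rw [map_div₀, map_pow, h', mul_pow, map_natCast, mul_div_right_comm]
    exact (isIntegral_sub_one_pow_div hp R.prim).mul (hw.pow _)
  have hint' : IsIntegral ℤ ((u : K) ^ (p - 1) / (p : K)) :=
    (isIntegral_algHom_iff ((algebraMap K E).toIntAlgHom) (algebraMap K E).injective).1 hint
  obtain ⟨z, hz⟩ := exists_coe_eq_of_isIntegral hint'
  refine ⟨z, NumberField.RingOfIntegers.ext ?_⟩
  have : (p : K) ≠ 0 := Nat.cast_ne_zero.2 hp.ne_zero
  simp only [NumberField.RingOfIntegers.coe_eq_algebraMap, map_mul, map_pow, map_natCast] at hz ⊢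
  rw [hz, mul_div_cancel₀ _ this]

include R in
omit [NumberField K] [NumberField L] in
theorem isIntegral_component (hp : p.Prime) (B : Module.Basis (Fin p) K L)
    (hB : ∀ j, B j = β ^ (j : ℕ)) {y : L} (hy : IsIntegral ℤ y) (j : Fin p) :
    IsIntegral ℤ ((p : L) * (B.repr y j • β ^ (j : ℕ))) := by
  rw [← isIntegral_map_iff R.ι, map_mul, map_natCast, ← R.sum_conj hp B hB]
  refine IsIntegral.sum _ fun i _ => IsIntegral.mul (IsIntegral.pow ?_ _) ?_
  · exact isIntegral_of_pow_prime_eq_one hp (by rw [inv_pow, R.prim.pow_eq_one, inv_one])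
  · exact (isIntegral_algHom_iff ((R.σ ^ i : E ≃ₐ[K] E) : E →+* E).toIntAlgHom
      (R.σ ^ i).injective).2 ((isIntegral_map_iff R.ι).2 hy)

-- The two components are the sums of ζ^{-ij} σ^i(y) and ζ^{-ik} σ^i(y), and every power of ζ is 1
-- modulo ζ - 1.
omit [NumberField K] [NumberField L] in
theorem component_sub_mem (hp : p.Prime) (B : Module.Basis (Fin p) K L)
    (hB : ∀ j, B j = β ^ (j : ℕ)) {y : L} (hy : IsIntegral ℤ y) {j k : Fin p} {z z' : 𝓞 L}
    (hz : (z : L) = (p : L) * (B.repr y j • β ^ (j : ℕ)))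
    (hz' : (z' : L) = (p : L) * (B.repr y k • β ^ (k : ℕ))) :
    z - z' ∈ R.congruenceIdeal := by
  have hone : R.ζ - 1 ≠ 0 := sub_ne_zero.2 (R.prim.ne_one hp.one_lt)
  have hinv : R.ζ⁻¹ ^ p = 1 := by rw [inv_pow, R.prim.pow_eq_one, inv_one]
  have hzint : IsIntegral ℤ R.ζ := isIntegral_of_pow_prime_eq_one hp R.prim.pow_eq_one
  have hpow : ∀ m : ℕ, IsIntegral ℤ ((R.ζ⁻¹ ^ m - 1) / (R.ζ - 1)) := by
    intro m
    have h1 : R.ζ⁻¹ = R.ζ ^ (p - 1) := by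
      refine inv_eq_of_mul_eq_one_right ?_
      rw [← pow_succ', Nat.sub_add_cancel hp.one_le, R.prim.pow_eq_one]
    rw [h1, ← pow_mul]
    exact isIntegral_pow_sub_one_div hp R.prim.pow_eq_one (R.prim.ne_one hp.one_lt) _
  refine ⟨∑ i ∈ Finset.range p, ((R.ζ⁻¹ ^ (i * (j : ℕ)) - 1) / (R.ζ - 1) -
    (R.ζ⁻¹ ^ (i * (k : ℕ)) - 1) / (R.ζ - 1)) * (R.σ ^ i) (R.ι y), ?_, ?_⟩
  · refine IsIntegral.sum _ fun i _ => ((hpow _).sub (hpow _)).mul ?_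
    exact (isIntegral_algHom_iff ((R.σ ^ i : E ≃ₐ[K] E) : E →+* E).toIntAlgHom
      (R.σ ^ i).injective).2 ((isIntegral_map_iff R.ι).2 hy)
  · rw [show ((z - z' : 𝓞 L) : L) = (z : L) - (z' : L) from rfl, map_sub, hz, hz', map_mul, map_mul, map_natCast, ← R.sum_conj hp B hB, ← R.sum_conj hp B hB,
      ← Finset.sum_sub_distrib, Finset.mul_sum]
    refine Finset.sum_congr rfl fun i _ => ?_
    field_simp
    ring

end RadicalConjugation

omit [NumberField L] in
/-- There is an ideal of `𝓞_L` that contains `p`, meets `𝓞_K` in `p 𝓞_K`, and modulo which `p`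
times the homogeneous components of an integer of `L` are all congruent. -/
theorem exists_congruenceIdeal (hp : p.Prime) (hunr : IsUnramifiedIn K p)
    (B : Module.Basis (Fin p) K L) (hB : ∀ j, B j = β ^ (j : ℕ)) (hb : β ^ p = algebraMap K L b) :
    ∃ J : Ideal (𝓞 L), (p : 𝓞 L) ∈ J ∧
      (∀ u : 𝓞 K, algebraMap (𝓞 K) (𝓞 L) u ∈ J → (p : 𝓞 K) ∣ u) ∧
      ∀ y : 𝓞 L, ∃ z : Fin p → 𝓞 L, (∀ j, (z j : L) = (p : L) * (B.repr (y : L) j • B j)) ∧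
        ∀ j k, z j - z k ∈ J := by
  obtain ⟨R⟩ := exists_radicalConjugation hp B hB hb
  refine ⟨R.congruenceIdeal, R.natCast_mem_congruenceIdeal hp, fun u hu =>
    hunr.dvd_of_dvd_pow hp (R.dvd_pow_of_mem_congruenceIdeal hp hu), fun y => ?_⟩
  choose z hz using fun j => exists_coe_eq_of_isIntegral
    (R.isIntegral_component hp B hB y.isIntegral_coe j)
  exact ⟨z, fun j => by rw [hz, hB], fun j k =>
    R.component_sub_mem hp B hB y.isIntegral_coe (hz j) (hz k)⟩

end CongruenceIdeal

end HopfGaloisRadical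

end

noncomputable section

namespace HopfGaloisRadical

/-! ### Prime exponents and the associated ideals -/

section AssociatedIdeal

open UniqueFactorizationMonoid

variable {K : Type*} [Field K] [NumberField K] {p : ℕ}

open Classical in
/-- The exponent of `P` in the factorization of the principal ideal generated by `a`. -/
def primeExponent (P : Ideal (𝓞 K)) (a : 𝓞 K) : ℕ :=
  (normalizedFactors (Ideal.span {a})).count P

theorem primeExponent_mul (P : Ideal (𝓞 K)) {a b : 𝓞 K} (ha : a ≠ 0) (hb : b ≠ 0) :
    primeExponent P (a * b) = primeExponent P a + primeExponent P b := by
  rw [primeExponent, ← Ideal.span_singleton_mul_span_singleton,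
    normalizedFactors_mul (by simpa) (by simpa), Multiset.count_add]
  rfl

theorem primeExponent_pow (P : Ideal (𝓞 K)) (a : 𝓞 K) (n : ℕ) :
    primeExponent P (a ^ n) = n * primeExponent P a := by
  rw [primeExponent, ← Ideal.span_singleton_pow, normalizedFactors_pow, Multiset.count_nsmul]
  rfl

theorem dvd_of_primeExponent_le {a b : 𝓞 K} (ha : a ≠ 0) (hb : b ≠ 0)
    (h : ∀ P, primeExponent P a ≤ primeExponent P b) : a ∣ b := by
  classical
  rw [← Ideal.mem_span_singleton, ← Ideal.dvd_span_singleton,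
    dvd_iff_normalizedFactors_le_normalizedFactors (by simpa) (by simpa), Multiset.le_iff_count]
  intro P
  have := h P
  rw [primeExponent, primeExponent] at this
  convert this

theorem primeExponent_eq_zero {P : Ideal (𝓞 K)} (hP : ¬ Prime P) (a : 𝓞 K) :
    primeExponent P a = 0 :=
  Multiset.count_eq_zero.2 fun h => hP (prime_of_normalized_factor P h)

theorem mem_pow_of_le_primeExponent {P : Ideal (𝓞 K)} {a : 𝓞 K} {n : ℕ} (ha : a ≠ 0)
    (hP : Prime P) (h : n ≤ primeExponent P a) : a ∈ P ^ n := by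
  classical
  rw [← Ideal.dvd_span_singleton,
    dvd_iff_normalizedFactors_le_normalizedFactors (pow_ne_zero _ hP.ne_zero) (by simpa),
    normalizedFactors_pow, normalizedFactors_irreducible hP.irreducible, normalize_eq,
    Multiset.nsmul_singleton, ← Multiset.le_count_iff_replicate_le]
  rw [primeExponent] at h
  convert h

open Classical in
theorem normalizedFactors_associatedIdeal (I : Ideal (𝓞 K)) (j : ℕ) :
    normalizedFactors (associatedIdeal p I j) =
      ∑ P ∈ (normalizedFactors I).toFinset, (j * (normalizedFactors I).count P / p) • {P} := by
  have : associatedIdeal p I j = (∑ P ∈ (normalizedFactors I).toFinset,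
      (j * (normalizedFactors I).count P / p) • ({P} : Multiset (Ideal (𝓞 K)))).prod := by
    rw [Multiset.prod_sum]
    simp [associatedIdeal, Multiset.nsmul_singleton]
  rw [this, normalizedFactors_prod_of_prime]
  intro P hP
  obtain ⟨Q, hQ, hPQ⟩ := Multiset.mem_sum.1 hP
  rw [Multiset.nsmul_singleton] at hPQ
  rw [Multiset.eq_of_mem_replicate hPQ]
  exact prime_of_normalized_factor Q (Multiset.mem_toFinset.1 hQ)

open Classical in
theorem count_associatedIdeal (b : 𝓞 K) (j : ℕ) (P : Ideal (𝓞 K)) :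
    (normalizedFactors (associatedIdeal p (Ideal.span {b}) j)).count P =
      j * primeExponent P b / p := by
  rw [normalizedFactors_associatedIdeal, Multiset.count_sum']
  simp only [Multiset.count_nsmul, Multiset.count_singleton]
  by_cases hP : P ∈ (normalizedFactors (Ideal.span {b})).toFinset
  · rw [Finset.sum_eq_single P]
    · simp [primeExponent]
    · intro Q _ hQ
      rw [if_neg (Ne.symm hQ), mul_zero]
    · exact fun h => absurd hP h
  · rw [primeExponent, Multiset.count_eq_zero.2 (fun h => hP (Multiset.mem_toFinset.2 h)),
      mul_zero, Nat.zero_div]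
    refine Finset.sum_eq_zero fun Q hQ => ?_
    rw [if_neg, mul_zero]
    rintro rfl
    exact hP hQ

theorem associatedIdeal_ne_zero (b : 𝓞 K) (j : ℕ) :
    associatedIdeal p (Ideal.span {b}) j ≠ 0 := by
  rw [associatedIdeal, Finset.prod_ne_zero_iff]
  intro P hP
  exact pow_ne_zero _ (prime_of_normalized_factor P (Multiset.mem_toFinset.1 hP)).ne_zero

theorem primeExponent_of_associatedIdeal_eq {b c : 𝓞 K} {j : ℕ}
    (h : associatedIdeal p (Ideal.span {b}) j = Ideal.span {c}) (P : Ideal (𝓞 K)) :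
    primeExponent P c = j * primeExponent P b / p := by
  rw [primeExponent, ← h, count_associatedIdeal]

theorem associatedIdeal_eq_of_primeExponent {b c : 𝓞 K} {j : ℕ} (hc : c ≠ 0)
    (h : ∀ P, primeExponent P c = j * primeExponent P b / p) :
    associatedIdeal p (Ideal.span {b}) j = Ideal.span {c} := by
  classical
  have hc' : Ideal.span {c} ≠ 0 := by simpa
  rw [← Ideal.prod_normalizedFactors_eq_self (associatedIdeal_ne_zero b j),
    ← Ideal.prod_normalizedFactors_eq_self hc']
  congr 1
  ext P
  have := (count_associatedIdeal (p := p) b j P).trans (h P).symm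
  rw [primeExponent] at this
  convert this

/-- At each P, p v(u) = v(D) - v(A) > -p, so v(u) > -1. The proof clears denominators to stay within
natural-number exponents. -/
theorem exists_coe_eq_of_primeExponent {u : K} {A D : 𝓞 K} (hp : 0 < p) (hA : A ≠ 0)
    (hD : D ≠ 0) (h : u ^ p * (A : K) = (D : K))
    (hlt : ∀ P, primeExponent P A < p + primeExponent P D) : ∃ z : 𝓞 K, (z : K) = u := by
  obtain ⟨r, s, hs, rfl⟩ := IsFractionRing.div_surjective (A := 𝓞 K) u
  have hs0 : s ≠ 0 := nonZeroDivisors.ne_zero hs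
  have hs0' : algebraMap (𝓞 K) K s ≠ 0 := by simpa using hs0
  have hrs : r ^ p * A = D * s ^ p := by
    apply NumberField.RingOfIntegers.ext
    simp only [NumberField.RingOfIntegers.coe_eq_algebraMap, map_mul, map_pow] at h ⊢
    rw [div_pow, div_mul_eq_mul_div, div_eq_iff (pow_ne_zero _ hs0')] at h
    exact h
  have hr0 : r ≠ 0 := by
    rintro rfl
    rw [zero_pow hp.ne', zero_mul] at hrs
    exact mul_ne_zero hD (pow_ne_zero _ hs0) hrs.symm
  obtain ⟨z, hz⟩ : s ∣ r := by
    refine dvd_of_primeExponent_le hs0 hr0 fun P => ?_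
    have h1 := congrArg (primeExponent P) hrs
    rw [primeExponent_mul P (pow_ne_zero _ hr0) hA, primeExponent_mul P hD (pow_ne_zero _ hs0),
      primeExponent_pow, primeExponent_pow] at h1
    have h2 := hlt P
    have h3 : p * primeExponent P s < p * (primeExponent P r + 1) := by
      rw [mul_add, mul_one]
      omega
    exact Nat.lt_succ_iff.1 (Nat.lt_of_mul_lt_mul_left h3)
  refine ⟨z, ?_⟩
  rw [hz, map_mul, mul_div_cancel_left₀ _ hs0']

/-- If `c` generates the `j`-th ideal associated to `b` and `u ^ p b ^ j / c ^ p` is integral,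
so is `u`. -/
theorem exists_coe_eq_of_associatedIdeal_eq (hp : 0 < p) {b c w : 𝓞 K} {j : ℕ} {u : K} (hb : b ≠ 0)
    (hc : c ≠ 0) (hbc : associatedIdeal p (Ideal.span {b}) j = Ideal.span {c})
    (h : u ^ p * ((b ^ j : 𝓞 K) : K) = ((w * c ^ p : 𝓞 K) : K)) : ∃ z : 𝓞 K, (z : K) = u := by
  by_cases hw : w = 0
  · refine ⟨0, ?_⟩
    have : ((b ^ j : 𝓞 K) : K) ≠ 0 := by
      simpa using fun h => absurd h hb
    rw [hw, zero_mul, show ((0 : 𝓞 K) : K) = 0 from map_zero _, mul_eq_zero, or_iff_left this,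
      pow_eq_zero_iff hp.ne'] at h
    rw [h]
    exact map_zero _
  · refine exists_coe_eq_of_primeExponent hp (pow_ne_zero _ hb) (mul_ne_zero hw (pow_ne_zero _ hc))
      h fun P => ?_
    rw [primeExponent_mul P hw (pow_ne_zero _ hc), primeExponent_pow, primeExponent_pow,
      primeExponent_of_associatedIdeal_eq hbc]
    -- Here v(c) = ⌊j v(b)/p⌋, so j v(b) < p v(c) + p, which is the bound required of the
    -- denominator.
    have := Nat.lt_mul_div_succ (j * primeExponent P b) hp
    rw [mul_add, mul_one] at this
    omega

/-- From j v(b) = p v(c) + v(W) with 0 ≤ v(W) < p, v(c) is the quotient of the Euclidean division,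
which is the floor in the definition. -/
theorem exists_generator_associatedIdeal (hp : 0 < p) {b W : 𝓞 K} {j : ℕ} {c : K} (hb : b ≠ 0)
    (hW : W ≠ 0) (hlt : ∀ P, Prime P → primeExponent P W < p)
    (h : c ^ p * (W : K) = ((b ^ j : 𝓞 K) : K)) :
    ∃ z : 𝓞 K, (z : K) = c ∧ associatedIdeal p (Ideal.span {b}) j = Ideal.span {z} := by
  have hlt' : ∀ P, primeExponent P W < p := fun P => by
    by_cases hP : Prime P
    · exact hlt P hP
    · rwa [primeExponent_eq_zero hP]
  obtain ⟨z, rfl⟩ := exists_coe_eq_of_primeExponent hp hW (pow_ne_zero j hb) h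
    fun P => (hlt' P).trans_le (Nat.le_add_right _ _)
  have hz : z ^ p * W = b ^ j := by
    apply NumberField.RingOfIntegers.ext
    simpa using h
  have hz0 : z ≠ 0 := by
    rintro rfl
    rw [zero_pow hp.ne', zero_mul] at hz
    exact pow_ne_zero _ hb hz.symm
  refine ⟨z, rfl, associatedIdeal_eq_of_primeExponent hz0 fun P => ?_⟩
  have h1 := congrArg (primeExponent P) hz
  rw [primeExponent_mul P (pow_ne_zero _ hz0) hW, primeExponent_pow, primeExponent_pow] at h1
  rw [← h1, Nat.mul_add_div hp, Nat.div_eq_of_lt (hlt' P), add_zero]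

end AssociatedIdeal

end HopfGaloisRadical

end

noncomputable section

namespace HopfGaloisRadical

/-! ### Tameness and the trace modulo primes above p -/

section TameTrace

attribute [local instance] Ideal.Quotient.field

/-- All quotients are finite, so it suffices to write both sides of |B/Q^e| = |B/Q|^e as powers of
|A/P|. -/
theorem finrank_quotient_pow {A B : Type*} [CommRing A] [CommRing B] [IsDedekindDomain B]
    [Module.Free ℤ B] [Module.Finite ℤ B] {P : Ideal A} [P.IsMaximal] [Finite (A ⧸ P)]
    {Q : Ideal B} {e : ℕ} (hQ : Q ≠ ⊥) [Module (A ⧸ P) (B ⧸ Q)] [Module (A ⧸ P) (B ⧸ Q ^ e)] :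
    Module.finrank (A ⧸ P) (B ⧸ Q ^ e) = e * Module.finrank (A ⧸ P) (B ⧸ Q) := by
  have hf : Finite (B ⧸ Q) := Ideal.finiteQuotientOfFreeOfNeBot Q hQ
  have hf' : Finite (B ⧸ Q ^ e) := Ideal.finiteQuotientOfFreeOfNeBot _ (pow_ne_zero e hQ)
  have h1 : Nat.card (B ⧸ Q ^ e) = Nat.card (B ⧸ Q) ^ e :=
    map_pow (Ideal.absNorm (S := B)) Q e
  rw [Module.natCard_eq_pow_finrank (K := A ⧸ P), Module.natCard_eq_pow_finrank (K := A ⧸ P)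
    (V := B ⧸ Q), ← pow_mul] at h1
  rw [Nat.pow_right_injective (Finite.one_lt_card_iff_nontrivial.2 inferInstance) h1, mul_comm]

variable {K L : Type*} [Field K] [Field L] [NumberField K] [NumberField L] [Algebra K L]
  {p : ℕ}

/-- In a tame extension of degree `p`, the trace is surjective modulo the primes over `p`. -/
theorem IsTame.exists_intTrace_notMem (hp : p.Prime) (hdeg : Module.finrank K L = p)
    (htame : IsTame K L) {P : Ideal (𝓞 K)} (hP : P.IsPrime) (hpP : (p : 𝓞 K) ∈ P) :
    ∃ y : 𝓞 L, Algebra.intTrace (𝓞 K) (𝓞 L) y ∉ P := by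
  have hp0 : (p : 𝓞 K) ≠ 0 := Nat.cast_ne_zero.2 hp.ne_zero
  have hPbot : P ≠ ⊥ := by
    rintro rfl
    exact hp0 hpP
  have hPmax : P.IsMaximal := hP.isMaximal hPbot
  have : Finite (𝓞 K ⧸ P) := Ideal.finiteQuotientOfFreeOfNeBot P hPbot
  have hchar : CharP (𝓞 K ⧸ P) p := by
    rw [CharP.charP_iff_prime_eq_zero hp, ← map_natCast (Ideal.Quotient.mk P),
      Ideal.Quotient.eq_zero_iff_mem]
    exact hpP
  obtain ⟨⟨Q, hQprime, hQover⟩⟩ := P.nonempty_primesOver (S := 𝓞 L)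
  have hQbot : Q ≠ ⊥ := Ideal.ne_bot_of_liesOver_of_ne_bot hPbot Q
  have hQmax : Q.IsMaximal := hQprime.isMaximal hQbot
  have hmap : P.map (algebraMap (𝓞 K) (𝓞 L)) ≠ ⊥ := Ideal.map_ne_bot_of_ne_bot hPbot
  have : Finite (𝓞 L ⧸ Q) := Ideal.finiteQuotientOfFreeOfNeBot Q hQbot
  have hcharQ : CharP (𝓞 L ⧸ Q) p := by
    rw [CharP.charP_iff_prime_eq_zero hp, ← map_natCast (Ideal.Quotient.mk Q),
      Ideal.Quotient.eq_zero_iff_mem]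
    have := (Ideal.mem_of_liesOver Q P _).1 hpP
    simpa using this
  have htameQ : ¬ p ∣ Q.ramificationIdx (𝓞 K) := by
    have := htame Q hQprime hQbot
    rwa [ringChar.eq (𝓞 L ⧸ Q) p] at this
  set e := Q.ramificationIdx (𝓞 K) with he
  have hmult := Ideal.IsDedekindDomain.ramificationIdx_eq_multiplicity P Q hmap
  have hfin : FiniteMultiplicity Q (P.map (algebraMap (𝓞 K) (𝓞 L))) :=
    FiniteMultiplicity.of_prime_left (Ideal.prime_of_isPrime hQbot hQprime) hmap
  obtain ⟨J, hJ, hQJ⟩ := hfin.exists_eq_pow_mul_and_not_dvd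
  rw [← hmult, ← he] at hJ
  have hcop : IsCoprime (Q ^ e) J := by
    refine IsCoprime.pow_left ?_
    rw [Ideal.isCoprime_iff_sup_eq]
    by_contra hne
    have : Q = Q ⊔ J := hQmax.eq_of_le hne le_sup_left
    exact hQJ (Ideal.dvd_iff_le.2 (this ▸ le_sup_right))
  let : Algebra (𝓞 K ⧸ P) (𝓞 L ⧸ Q ^ e) := Ideal.Quotient.algebraQuotientOfLEComap (by
    rw [← Ideal.map_le_iff_le_comap, hJ]
    exact Ideal.mul_le_left)
  let : Algebra (𝓞 K ⧸ P) (𝓞 L ⧸ J) := Ideal.Quotient.algebraQuotientOfLEComap (by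
    rw [← Ideal.map_le_iff_le_comap, hJ]
    exact Ideal.mul_le_right)
  have : IsScalarTower (𝓞 K) (𝓞 K ⧸ P) (𝓞 L ⧸ Q ^ e) := .of_algebraMap_eq' rfl
  have : IsScalarTower (𝓞 K) (𝓞 K ⧸ P) (𝓞 L ⧸ J) := .of_algebraMap_eq' rfl
  have : Module.Finite (𝓞 K ⧸ P) (𝓞 L ⧸ Q ^ e) :=
    Module.Finite.of_restrictScalars_finite (𝓞 K) (𝓞 K ⧸ P) (𝓞 L ⧸ Q ^ e)
  have : Module.Finite (𝓞 K ⧸ P) (𝓞 L ⧸ J) :=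
    Module.Finite.of_restrictScalars_finite (𝓞 K) (𝓞 K ⧸ P) (𝓞 L ⧸ J)
  suffices ∃ y, Algebra.trace (𝓞 K ⧸ P) (𝓞 L ⧸ P.map (algebraMap (𝓞 K) (𝓞 L))) y ≠ 0 by
    obtain ⟨y, hy⟩ := this
    obtain ⟨y, rfl⟩ := Ideal.Quotient.mk_surjective y
    refine ⟨y, ?_⟩
    rwa [Algebra.trace_quotient_eq_of_isDedekindDomain, ne_eq,
      Ideal.Quotient.eq_zero_iff_mem] at hy
  -- If p divides ef, tameness gives p ∣ f, so f = p = [L : K] and P𝓞_L = Q; the trace of an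
  -- extension of finite fields is nonzero. Otherwise the idempotent (1, 0) of 𝓞_L/Q^e × 𝓞_L/J has
  -- trace ef ≠ 0 in characteristic p.
  by_cases hdvd : p ∣ Module.finrank (𝓞 K ⧸ P) (𝓞 L ⧸ Q ^ e)
  · rw [finrank_quotient_pow hQbot] at hdvd
    have hf := ((Nat.Prime.dvd_mul hp).1 hdvd).resolve_left htameQ
    have hf' := Nat.le_of_dvd Module.finrank_pos hf
    have htot : Module.finrank (𝓞 K ⧸ P) (𝓞 L ⧸ P.map (algebraMap (𝓞 K) (𝓞 L))) = p := by
      rw [Ideal.finrank_quotient_map P K L, hdeg]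
    have hle : P.map (algebraMap (𝓞 K) (𝓞 L)) ≤ Q := Ideal.map_le_of_le_comap (Ideal.over_def Q P).le
    let φ : (𝓞 L ⧸ P.map (algebraMap (𝓞 K) (𝓞 L))) →ₐ[𝓞 K ⧸ P] (𝓞 L ⧸ Q) :=
      { __ := Ideal.Quotient.factor hle
        commutes' := Quotient.ind fun _ => rfl }
    have hφ : Function.Surjective φ := Ideal.Quotient.factor_surjective hle
    have hfr : Module.finrank (𝓞 K ⧸ P) (𝓞 L ⧸ P.map (algebraMap (𝓞 K) (𝓞 L))) =
        Module.finrank (𝓞 K ⧸ P) (𝓞 L ⧸ Q) :=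
      le_antisymm (htot ▸ hf') (LinearMap.finrank_le_finrank_of_surjective (f := φ.toLinearMap) hφ)
    have hφ' : Function.Injective φ :=
      (LinearMap.injective_iff_surjective_of_finrank_eq_finrank (f := φ.toLinearMap) hfr).2 hφ
    let ε := AlgEquiv.ofBijective φ ⟨hφ', hφ⟩
    obtain ⟨x, hx⟩ : ∃ x, Algebra.trace (𝓞 K ⧸ P) (𝓞 L ⧸ Q) x ≠ 0 := by
      simpa [LinearMap.ext_iff] using Algebra.trace_ne_zero (𝓞 K ⧸ P) (𝓞 L ⧸ Q)
    refine ⟨ε.symm x, ?_⟩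
    rwa [Algebra.trace_eq_of_algEquiv]
  · let ε : (𝓞 L ⧸ P.map (algebraMap (𝓞 K) (𝓞 L))) ≃ₐ[𝓞 K ⧸ P] ((𝓞 L ⧸ Q ^ e) × 𝓞 L ⧸ J) :=
      { __ := (Ideal.quotEquivOfEq hJ).trans (Ideal.quotientMulEquivQuotientProd (Q ^ e) J hcop)
        commutes' := Quotient.ind fun _ => rfl }
    refine ⟨ε.symm (1, 0), ?_⟩
    rw [Algebra.trace_eq_of_algEquiv, Algebra.trace_prod_apply, map_zero, add_zero,
      ← map_one (algebraMap (𝓞 K ⧸ P) _), Algebra.trace_algebraMap, nsmul_one, ne_eq,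
      CharP.cast_eq_zero_iff _ p]
    exact hdvd

end TameTrace

end HopfGaloisRadical

end

noncomputable section

namespace HopfGaloisRadical

/-! ### Diagonal operators and the trace in coordinates -/

section DiagonalAction

variable {K L H : Type*} [Field K] [Field L] [Algebra K L] [Ring H] [Algebra K H]
  [Module H L] [IsScalarTower K H L] {p : ℕ} {B : Module.Basis (Fin p) K L}
  {χ : H ≃ₗ[K] (Fin p → K)}

theorem repr_smul_of_diagonal (hχ : ∀ h j, h • B j = χ h j • B j) (h : H) (y : L) (j : Fin p) :
    B.repr (h • y) j = χ h j * B.repr y j := by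
  have : h • y = ∑ i, (χ h i * B.repr y i) • B i := by
    change (Algebra.lsmul K K L h : L →ₗ[K] L) y = _
    conv_lhs => rw [← B.sum_repr y]
    rw [map_sum]
    refine Finset.sum_congr rfl fun i _ => ?_
    rw [map_smul, mul_comm, mul_smul, ← hχ]
    rfl
  rw [this, B.repr_sum_self]

theorem single_smul_of_diagonal (hχ : ∀ h j, h • B j = χ h j • B j) (j : Fin p) (t : K) (y : L) :
    χ.symm (Pi.single j t) • y = (t * B.repr y j) • B j := by
  refine B.repr.injective (Finsupp.ext fun i => ?_)
  rw [repr_smul_of_diagonal hχ, LinearEquiv.apply_symm_apply]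
  by_cases h : i = j
  · subst h; simp
  · simp [h]

variable {β : L} {b : K}

/-- For 0 < j < p, multiplication by β^j shifts exponents modulo p without fixing any, so its matrix
has zero diagonal. -/
theorem trace_eq_mul_repr [NeZero p] (hB : ∀ j, B j = β ^ (j : ℕ)) (hb : β ^ p = algebraMap K L b)
    (y : L) : Algebra.trace K L y = p * B.repr y 0 := by
  have hmul : ∀ i j : Fin p, j ≠ 0 → B.repr (B j * B i) i = 0 := by
    intro i j hj
    have hj0 : (j : ℕ) ≠ 0 := fun h => hj (Fin.ext h)
    rw [hB, hB, ← pow_add]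
    by_cases hlt : (j : ℕ) + i < p
    · rw [← hB ⟨_, hlt⟩, B.repr_self, Finsupp.single_apply, if_neg]
      intro h
      have := congrArg Fin.val h
      simp at this
      exact hj this
    · have hlt' : (j : ℕ) + i - p < p := by omega
      have : β ^ ((j : ℕ) + i) = b • β ^ ((j : ℕ) + i - p) := by
        rw [Algebra.smul_def, ← hb, ← pow_add]
        congr 1
        omega
      rw [this, ← hB ⟨_, hlt'⟩, map_smul, B.repr_self, Finsupp.smul_apply,
        Finsupp.single_apply, if_neg, smul_zero]
      intro h
      have := congrArg Fin.val h
      simp only at this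
      omega
  have htr : ∀ j : Fin p, j ≠ 0 → Algebra.trace K L (B j) = 0 := by
    intro j hj
    rw [Algebra.trace_eq_matrix_trace B, Matrix.trace]
    refine Finset.sum_eq_zero fun i _ => ?_
    rw [Matrix.diag_apply, Algebra.leftMulMatrix_eq_repr_mul, hmul i j hj]
  conv_lhs => rw [← B.sum_repr y]
  rw [map_sum, Finset.sum_eq_single 0]
  · rw [map_smul, hB, Fin.val_zero, pow_zero, ← map_one (algebraMap K L), Algebra.trace_algebraMap,
      Module.finrank_eq_card_basis B, Fintype.card_fin, nsmul_one, smul_eq_mul, mul_comm]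
  · intro j _ hj
    rw [map_smul, htr j hj, smul_zero]
  · simp

end DiagonalAction

/-! ### Sufficiency of the criterion -/

section Criterion

variable {K L H : Type*} [Field K] [NumberField K] [Field L] [NumberField L] [Algebra K L]
  [Ring H] [HopfAlgebra K H] [Module H L] [IsScalarTower K H L] {p : ℕ}

/-- For a datum as in the criterion, the coordinates of an integer with respect to the elements
`β ^ j / (p c_j)` are integers congruent modulo `p`. -/
theorem exists_integral_coordinates [NeZero p] {b : 𝓞 K} {β : L} {c : Fin p → 𝓞 K}
    {B : Module.Basis (Fin p) K L}
    (hB : ∀ j, B j = β ^ (j : ℕ)) (hb : β ^ p = algebraMap K L (b : K)) (hb0 : b ≠ 0)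
    (hc : ∀ j : Fin p, associatedIdeal p (Ideal.span {b}) j = Ideal.span {c j})
    (hc0 : ∀ j, c j ≠ 0) {J : Ideal (𝓞 L)}
    (hJK : ∀ u : 𝓞 K, algebraMap (𝓞 K) (𝓞 L) u ∈ J → (p : 𝓞 K) ∣ u)
    (hJ : ∀ y : 𝓞 L, ∃ z : Fin p → 𝓞 L, (∀ j, (z j : L) = (p : L) * (B.repr (y : L) j • B j)) ∧
      ∀ j k, z j - z k ∈ J)
    {x : 𝓞 L} (hx : ∀ j, B.repr (x : L) j = 1 / ((p : K) * (c j : K))) (y : 𝓞 L) :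
    ∃ Y : Fin p → 𝓞 K, (∀ j, (Y j : K) = (p : K) * (c j : K) * B.repr (y : L) j) ∧
      ∀ j, (p : 𝓞 K) ∣ Y j - Y 0 := by
  have hp0 : (p : K) ≠ 0 := Nat.cast_ne_zero.2 (NeZero.ne p)
  have hcK : ∀ j, (c j : K) ≠ 0 := fun j => by simpa using hc0 j
  obtain ⟨zy, hzy, hzyJ⟩ := hJ y
  obtain ⟨zx, hzx, hzxJ⟩ := hJ x
  have hY : ∀ j, ∃ Y : 𝓞 K, (Y : K) = (p : K) * (c j : K) * B.repr (y : L) j := by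
    intro j
    have h1 : ((zy j : L)) ^ p = algebraMap K L (((p : K) * B.repr (y : L) j) ^ p * (b : K) ^ (j : ℕ)) := by
      rw [hzy, hB, Algebra.smul_def, mul_pow, mul_pow, ← pow_mul, mul_comm (j : ℕ), pow_mul, hb]
      simp only [map_mul, map_pow, map_natCast]
      ring
    have h2 : IsIntegral ℤ (((p : K) * B.repr (y : L) j) ^ p * (b : K) ^ (j : ℕ)) := by
      rw [← isIntegral_algHom_iff ((algebraMap K L).toIntAlgHom) (algebraMap K L).injective]
      change IsIntegral ℤ (algebraMap K L _)
      rw [← h1]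
      exact (zy j).isIntegral_coe.pow p
    obtain ⟨w, hw⟩ := exists_coe_eq_of_isIntegral h2
    refine exists_coe_eq_of_associatedIdeal_eq (w := w) (NeZero.pos p) hb0 (hc0 j) (hc j) ?_
    simp only [NumberField.RingOfIntegers.coe_eq_algebraMap, map_mul, map_pow] at hw ⊢
    rw [hw]
    ring
  choose Y hY using hY
  refine ⟨Y, hY, fun j => hJK _ ?_⟩
  -- Each component of p y is Y_j times that of p x. Modulo J the components on either side do not
  -- depend on j, so (Y_j - Y_0) times the component of p x at 0 lies in J.
  have hprod : ∀ j, zy j = algebraMap (𝓞 K) (𝓞 L) (Y j) * zx j := by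
    intro j
    apply NumberField.RingOfIntegers.ext
    have h1 : ((algebraMap (𝓞 K) (𝓞 L) (Y j) * zx j : 𝓞 L) : L) =
        algebraMap K L (Y j : K) * (zx j : L) := rfl
    rw [h1, hzy, hzx, hY, hx, Algebra.smul_def, Algebra.smul_def]
    have h2 : algebraMap K L (c j : K) ≠ 0 := (map_ne_zero _).2 (hcK j)
    have h3 : (p : L) ≠ 0 := Nat.cast_ne_zero.2 (NeZero.ne p)
    simp only [map_mul, map_natCast, map_div₀, map_one]
    field_simp
  -- The component of p x at 0 is 1/c_0, a unit of 𝓞_L, so it cancels from the congruence.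
  have hx0 : algebraMap (𝓞 K) (𝓞 L) (c 0) * zx 0 = 1 := by
    apply NumberField.RingOfIntegers.ext
    have h1 : ((algebraMap (𝓞 K) (𝓞 L) (c 0) * zx 0 : 𝓞 L) : L) =
        algebraMap K L (c 0 : K) * (zx 0 : L) := rfl
    rw [h1, hzx, hx, hB, Fin.val_zero, pow_zero, Algebra.smul_def, mul_one,
      ← map_natCast (algebraMap K L), ← map_mul, ← map_mul, show ((1 : 𝓞 L) : L) = 1 from rfl]
    have := hcK 0
    rw [← map_one (algebraMap K L)]
    congr 1
    field_simp
  have h3 : (algebraMap (𝓞 K) (𝓞 L) (Y j) - algebraMap (𝓞 K) (𝓞 L) (Y 0)) * zx 0 ∈ J := by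
    have : (algebraMap (𝓞 K) (𝓞 L) (Y j) - algebraMap (𝓞 K) (𝓞 L) (Y 0)) * zx 0 =
        (zy j - zy 0) - algebraMap (𝓞 K) (𝓞 L) (Y j) * (zx j - zx 0) := by
      rw [hprod j, hprod 0]
      ring
    rw [this]
    exact J.sub_mem (hzyJ j 0) (J.mul_mem_left _ (hzxJ j 0))
  have h4 := J.mul_mem_left (algebraMap (𝓞 K) (𝓞 L) (c 0)) h3
  rwa [mul_left_comm, hx0, mul_one, ← map_sub] at h4

/-- No coordinate of x vanishes, so a diagonal operator is determined by its value at x. The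
operator reaching y is diag(Y_j), and the congruences Y_j ≡ Y_0 mod p put it in the associated
order. -/
theorem IsCriterionDatum.exists_isFreeGenerator (hp : p.Prime) (hunr : IsUnramifiedIn K p)
    (hdeg : Module.finrank K L = p) (hH : IsHopfGalois K L H) {β : 𝓞 L} {c : Fin p → 𝓞 K}
    (hd : IsCriterionDatum p β c) :
    ∃ x : 𝓞 L, (x : L) = 1 / (p : L) * radicalSum p β c ∧
      IsFreeGenerator (associatedOrder L H) x := by
  have : NeZero p := ⟨hp.ne_zero⟩
  obtain ⟨B, hB⟩ := exists_basis_pow hp hdeg hd.adjoin_eq_top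
  obtain ⟨b, hb, hc⟩ := hd.exists_pow_eq
  have hb' : (β : L) ^ p = algebraMap K L (b : K) := by
    have := congrArg (fun y : 𝓞 L => (y : L)) hb
    exact this.symm
  have hβ0 : (β : L) ≠ 0 := by
    have := B.ne_zero ⟨1, hp.one_lt⟩
    simpa [hB] using this
  have hb0 : b ≠ 0 := by
    rintro rfl
    rw [show ((0 : 𝓞 K) : K) = 0 from rfl, map_zero] at hb'
    exact pow_ne_zero _ hβ0 hb'
  have hc0 : ∀ j, c j ≠ 0 := by
    intro j h
    refine associatedIdeal_ne_zero (p := p) b j ?_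
    rw [hc, h]
    simp
  obtain ⟨χ, hχ⟩ := hH.exists_diagonal hp B hB hb'
  obtain ⟨J, hJp, hJK, hJ⟩ := exists_congruenceIdeal hp hunr B hB hb'
  obtain ⟨x, hx⟩ := hd.radicalSum_mem
  have hpL : (p : L) ≠ 0 := Nat.cast_ne_zero.2 hp.ne_zero
  have hpK : (p : K) ≠ 0 := Nat.cast_ne_zero.2 hp.ne_zero
  have hcK : ∀ j, (c j : K) ≠ 0 := fun j => by simpa using hc0 j
  have hx' : (x : L) = 1 / (p : L) * radicalSum p β c := by
    rw [hx]; field_simp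
  have hxB : ∀ j, B.repr (x : L) j = 1 / ((p : K) * (c j : K)) := by
    intro j
    have : (x : L) = ∑ j, (1 / ((p : K) * (c j : K))) • B j := by
      rw [hx', radicalSum, Finset.mul_sum]
      refine Finset.sum_congr rfl fun i _ => ?_
      rw [hB, Algebra.smul_def, map_div₀, map_mul, map_natCast, map_one]
      have : algebraMap K L (c i : K) ≠ 0 := (map_ne_zero _).2 (hcK i)
      field_simp
    rw [this, B.repr_sum_self]
  have hcoord := exists_integral_coordinates hB hb' hb0 hc hc0 hJK hJ hxB
  refine ⟨x, hx', ?_, ?_⟩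
  · intro a a' h
    have h1 : (a : H) • (x : L) = (a' : H) • (x : L) := congrArg (fun y : 𝓞 L => (y : L)) h
    refine Subtype.ext (χ.injective (funext fun j => ?_))
    have h2 := congrArg (fun y => B.repr y j) h1
    simp only [repr_smul_of_diagonal hχ, hxB] at h2
    exact mul_right_cancel₀ (one_div_ne_zero (mul_ne_zero hpK (hcK j))) h2
  · intro y
    obtain ⟨Y, hY, hYp⟩ := hcoord y
    let h : H := χ.symm fun j => (Y j : K)
    have hh : h ∈ associatedOrder L H := by
      intro z hz
      obtain ⟨z, rfl⟩ := exists_coe_eq_of_isIntegral hz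
      obtain ⟨zc, hzc, -⟩ := hJ z
      choose u hu using hYp
      -- h = Y_0 + ∑ u_j p e_j, and each p e_j preserves integers.
      have : h • (z : L) = ((algebraMap (𝓞 K) (𝓞 L) (Y 0) * z +
          ∑ j, algebraMap (𝓞 K) (𝓞 L) (u j) * zc j : 𝓞 L) : L) := by
        have hcast : ((algebraMap (𝓞 K) (𝓞 L) (Y 0) * z +
            ∑ j, algebraMap (𝓞 K) (𝓞 L) (u j) * zc j : 𝓞 L) : L) =
            (Y 0 : K) • (z : L) + ∑ j, (u j : K) • (zc j : L) := by
          simp only [NumberField.RingOfIntegers.coe_eq_algebraMap, map_add, map_mul, map_sum,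
            Algebra.smul_def]
          rfl
        rw [hcast]
        refine B.repr.injective (Finsupp.ext fun j => ?_)
        have hzc' : ∀ j, (u j : K) • (zc j : L) = ((u j : K) * (p * B.repr (z : L) j)) • B j := by
          intro j
          rw [hzc]
          simp only [Algebra.smul_def, map_mul, map_natCast]
          ring
        rw [repr_smul_of_diagonal hχ]
        simp only [hzc']
        rw [map_add, Finsupp.add_apply, B.repr_sum_self, map_smul, Finsupp.smul_apply]
        have huK : (Y j : K) - (Y 0 : K) = p * (u j : K) := by
          have := congrArg (fun t : 𝓞 K => (t : K)) (hu j)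
          simpa using this
        simp only [h, LinearEquiv.apply_symm_apply, smul_eq_mul]
        linear_combination (B.repr (z : L) j) * huK
      rw [this]
      exact NumberField.RingOfIntegers.isIntegral_coe _
    refine ⟨⟨h, hh⟩, NumberField.RingOfIntegers.ext ?_⟩
    change h • (x : L) = (y : L)
    refine B.repr.injective (Finsupp.ext fun j => ?_)
    rw [repr_smul_of_diagonal hχ, hxB]
    simp only [h, LinearEquiv.apply_symm_apply, hY]
    have := hcK j
    field_simp

end Criterion

end HopfGaloisRadical

end

noncomputable section

namespace HopfGaloisRadical

/-! ### Freeness over the associated order means rank one -/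

section FreeGenerator

theorem IsFreeGenerator.free {A M : Type*} [Ring A] [AddCommGroup M] [Module A M] {x : M}
    (hx : IsFreeGenerator A x) : Module.Free A M :=
  .of_equiv (LinearEquiv.ofBijective (LinearMap.toSpanSingleton A M x) hx)

variable {K L H : Type*} [Field K] [NumberField K] [Field L] [NumberField L] [Algebra K L]
  [Ring H] [Algebra K H] [Module H L] [IsScalarTower K H L] {p : ℕ}
  {B : Module.Basis (Fin p) K L} {χ : H ≃ₗ[K] (Fin p → K)}

omit [NumberField K] [NumberField L] in
theorem single_mem_associatedOrder (hχ : ∀ h j, h • B j = χ h j • B j)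
    (hint : ∀ (y : 𝓞 L) (j), IsIntegral ℤ ((p : L) * (B.repr (y : L) j • B j)))
    (j : Fin p) (t : 𝓞 K) : χ.symm (Pi.single j ((t : K) * p)) ∈ associatedOrder L H := by
  intro y hy
  obtain ⟨y, rfl⟩ := exists_coe_eq_of_isIntegral hy
  rw [single_smul_of_diagonal hχ]
  have : ((t : K) * p * B.repr (y : L) j) • B j =
      algebraMap K L (t : K) * ((p : L) * (B.repr (y : L) j • B j)) := by
    simp only [Algebra.smul_def, map_mul, map_natCast]
    ring
  rw [this]
  refine IsIntegral.mul ?_ (hint y j)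
  exact (isIntegral_algHom_iff ((algebraMap K L).toIntAlgHom) (algebraMap K L).injective).2
    t.isIntegral_coe

-- If coordinate j vanished, the nonzero element p e_j of the associated order would annihilate x.
omit [NumberField L] in
theorem repr_ne_zero_of_smul_eq_zero (hp : p ≠ 0) (hχ : ∀ h j, h • B j = χ h j • B j)
    (hint : ∀ (y : 𝓞 L) (j), IsIntegral ℤ ((p : L) * (B.repr (y : L) j • B j)))
    {x : 𝓞 L} (hx : ∀ a : associatedOrder L H, a • x = 0 → a = 0) (j : Fin p) :
    B.repr (x : L) j ≠ 0 := by
  intro h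
  have h1 := hx ⟨_, single_mem_associatedOrder hχ hint j 1⟩ (NumberField.RingOfIntegers.ext (by
    rw [coe_associatedOrder_smul, single_smul_of_diagonal hχ, h, mul_zero, zero_smul]
    rfl))
  have h2 := congrArg (fun a : associatedOrder L H => χ (a : H) j) h1
  simp [hp] at h2

/-- If `𝓞_L` is free over its associated order, it is free of rank one. -/
theorem exists_isFreeGenerator_of_free [NeZero p] (hχ : ∀ h j, h • B j = χ h j • B j)
    (hB0 : B 0 = 1)
    (hint : ∀ (y : 𝓞 L) (j), IsIntegral ℤ ((p : L) * (B.repr (y : L) j • B j)))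
    (hfree : Module.Free (associatedOrder L H) (𝓞 L)) :
    ∃ x : 𝓞 L, IsFreeGenerator (associatedOrder L H) x := by
  classical
  let b := Module.Free.chooseBasis (associatedOrder L H) (𝓞 L)
  have hann : ∀ i (a : associatedOrder L H), a • b i = 0 → a = 0 := by
    intro i a h
    have := congrArg (fun y => b.repr y i) h
    simpa using this
  have hcoef := fun i => repr_ne_zero_of_smul_eq_zero (NeZero.ne p) hχ hint (hann i) 0
  have hnum : ∀ i, ∃ t : 𝓞 K, (t : K) = p * B.repr (b i : L) 0 := by
    intro i
    refine exists_coe_eq_of_isIntegral ?_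
    have := hint (b i) 0
    rw [hB0, Algebra.smul_def, mul_one, ← map_natCast (algebraMap K L), ← map_mul] at this
    exact (isIntegral_algHom_iff ((algebraMap K L).toIntAlgHom) (algebraMap K L).injective).1 this
  choose t ht using hnum
  have hpK : (p : K) ≠ 0 := Nat.cast_ne_zero.2 (NeZero.ne p)
  have ht0 : ∀ i, (t i : K) ≠ 0 := fun i => by rw [ht]; exact mul_ne_zero hpK (hcoef i)
  have hsub : ∀ i k : Module.Free.ChooseBasisIndex (associatedOrder L H) (𝓞 L), i = k := by
    intro i k
    by_contra hne
    let a : associatedOrder L H := ⟨_, single_mem_associatedOrder hχ hint 0 (t k)⟩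
    let a' : associatedOrder L H := ⟨_, single_mem_associatedOrder hχ hint 0 (t i)⟩
    -- Both sides equal t_i t_k: after p e_0, any two elements are proportional over 𝓞_K, so two
    -- distinct basis elements would be dependent.
    have h1 : a • b i = a' • b k := by
      apply NumberField.RingOfIntegers.ext
      rw [coe_associatedOrder_smul, coe_associatedOrder_smul]
      simp only [a, a', single_smul_of_diagonal hχ]
      congr 1
      rw [mul_assoc, mul_assoc, ← ht, ← ht, mul_comm]
    have h2 := congrArg (fun y => b.repr y i) h1
    simp only [map_smul, Module.Basis.repr_self, Finsupp.smul_apply, Finsupp.single_apply,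
      if_pos, if_neg (Ne.symm hne), smul_eq_mul, mul_one, mul_zero] at h2
    have h3 := congrArg (fun a : associatedOrder L H => χ (a : H) 0) h2
    simp [a, hpK] at h3
    exact ht0 k (by simp [h3])
  have hne : Nonempty (Module.Free.ChooseBasisIndex (associatedOrder L H) (𝓞 L)) := by
    by_contra hempty
    rw [not_nonempty_iff] at hempty
    have : (1 : 𝓞 L) = 0 := by
      apply b.repr.injective
      ext i
      exact isEmptyElim i
    exact one_ne_zero this
  obtain ⟨i⟩ := hne
  refine ⟨b i, ?_, ?_⟩
  · intro a a' h
    have := hann i (a - a') (by rw [sub_smul]; exact sub_eq_zero.2 h)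
    exact sub_eq_zero.1 this
  · intro y
    refine ⟨b.repr y i, ?_⟩
    apply b.repr.injective
    ext k
    rw [hsub k i]
    simp

end FreeGenerator

/-! ### Necessity of the criterion -/

section Necessity

variable {K L H : Type*} [Field K] [NumberField K] [Field L] [NumberField L] [Algebra K L]
  [Ring H] [Algebra K H] [Module H L] [IsScalarTower K H L] {p : ℕ}
  {B : Module.Basis (Fin p) K L} {χ : H ≃ₗ[K] (Fin p → K)}

/-- The quotient r/s has exponent -1 at P and is integral at all other primes, since r P ⊆ I P =
(s). It serves as an inverse uniformizer without localizing. -/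
theorem exists_local_inverse {P : Ideal (𝓞 K)} (hP : Prime P) :
    ∃ (s r : 𝓞 K) (I : Ideal (𝓞 K)), s ∈ P ∧ s ∉ P ^ 2 ∧ r ∉ P ∧ r ∈ I ∧ Ideal.span {s} = P * I := by
  have hP' : P.IsPrime := Ideal.isPrime_of_prime hP
  obtain ⟨s, hs, hs2⟩ := Ideal.exists_mem_pow_notMem_pow_succ P hP.ne_zero hP'.ne_top 1
  rw [pow_one] at hs
  obtain ⟨I, hI⟩ := Ideal.dvd_span_singleton.2 hs
  have hIP : ¬ I ≤ P := by
    intro hle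
    apply hs2
    have h1 : s ∈ P * I := hI ▸ Ideal.mem_span_singleton_self s
    rw [one_add_one_eq_two, sq]
    exact Ideal.mul_mono_right hle h1
  obtain ⟨r, hrI, hrP⟩ := SetLike.not_le_iff_exists.1 hIP
  exact ⟨s, r, I, hs, hs2, hrP, hrI, hI⟩

/-- The exponents of the `p`-th powers of the homogeneous components of `p x` are less than `p`,
if `x` is a free generator. -/
theorem primeExponent_lt_of_isFreeGenerator [NeZero p] (hp : p.Prime) (hunr : IsUnramifiedIn K p)
    (htame : IsTame K L) {ω : L} {a : K} (hB : ∀ j, B j = ω ^ (j : ℕ))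
    (hω : ω ^ p = algebraMap K L a)
    (hχ : ∀ h j, h • B j = χ h j • B j) {J : Ideal (𝓞 L)} (hJp : (p : 𝓞 L) ∈ J)
    (hJK : ∀ u : 𝓞 K, algebraMap (𝓞 K) (𝓞 L) u ∈ J → (p : 𝓞 K) ∣ u)
    (hJ : ∀ y : 𝓞 L, ∃ z : Fin p → 𝓞 L, (∀ j, (z j : L) = (p : L) * (B.repr (y : L) j • B j)) ∧
      ∀ j k, z j - z k ∈ J)
    {x : 𝓞 L} (hx : IsFreeGenerator (associatedOrder L H) x)
    (hx0 : ∀ j, B.repr (x : L) j ≠ 0) {j : Fin p} {w : 𝓞 L} {W : 𝓞 K}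
    (hw : (w : L) = (p : L) * (B.repr (x : L) j • B j)) (hW : algebraMap (𝓞 K) (𝓞 L) W = w ^ p)
    (hW0 : W ≠ 0)
    {P : Ideal (𝓞 K)} (hP : Prime P) : primeExponent P W < p := by
  have hprime : P.IsPrime := Ideal.isPrime_of_prime hP
  by_contra! hle
  have hWP : W ∈ P ^ p := mem_pow_of_le_primeExponent hW0 hP hle
  obtain ⟨s, r, I, hsP, hsP2, hrP, hrI, hsI⟩ := exists_local_inverse hP
  have hs0 : s ≠ 0 := by
    rintro rfl
    exact hsP2 (Ideal.zero_mem _)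
  have hsK : (s : K) ≠ 0 := by simpa using hs0
  have hWL : (w : L) ^ p = algebraMap K L (W : K) :=
    (congrArg (fun y : 𝓞 L => (y : L)) hW).symm
  obtain ⟨π, hπ⟩ : ∃ π : K, π = (r : K) / (s : K) := ⟨_, rfl⟩
  have hsπ : (s : K) * π = (r : K) := by rw [hπ, mul_div_cancel₀ _ hsK]
  -- `π w` is integral
  have hint : IsIntegral ℤ (π • (w : L)) := by
    -- r ∈ I and W ∈ P^p give r^p W ∈ (I P)^p = (s^p), so (π w)^p is integral.
    obtain ⟨v, hv⟩ : s ^ p ∣ r ^ p * W := by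
      rw [← Ideal.mem_span_singleton, ← Ideal.span_singleton_pow, hsI, mul_pow, mul_comm (P ^ p)]
      exact Ideal.mul_mem_mul (Ideal.pow_mem_pow hrI p) hWP
    refine IsIntegral.of_pow hp.pos ?_
    have h1 : (π • (w : L)) ^ p = algebraMap K L (v : K) := by
      rw [Algebra.smul_def, mul_pow, hWL, ← map_pow, ← map_mul]
      congr 1
      have h2 := congrArg (fun y : 𝓞 K => (y : K)) hv
      simp only [map_mul, map_pow] at h2
      refine mul_left_cancel₀ (pow_ne_zero p hsK) ?_
      rw [← mul_assoc, ← mul_pow, hsπ]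
      exact h2
    rw [h1]
    exact (isIntegral_algHom_iff ((algebraMap K L).toIntAlgHom) (algebraMap K L).injective).2
      v.isIntegral_coe
  obtain ⟨g, hg⟩ := exists_coe_eq_of_isIntegral hint
  obtain ⟨α, hα⟩ := hx.2 g
  have hα' : (α : H) • (x : L) = π • (w : L) := by
    rw [← hg]
    exact congrArg (fun y : 𝓞 L => (y : L)) hα
  have hwB : (w : L) = ((p : K) * B.repr (x : L) j) • B j := by
    rw [hw, Algebra.smul_def, Algebra.smul_def, map_mul, map_natCast, mul_assoc]
  -- α x = π w is concentrated in degree j and no coordinate of x vanishes, so α = π p e_j; thus π p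
  -- e_j preserves 𝓞_L, which is too strong in both cases below.
  have hχα : χ (α : H) = Pi.single j (π * p) := by
    funext i
    have h1 := congrArg (fun y => B.repr y i) hα'
    simp only [repr_smul_of_diagonal hχ, hwB, map_smul, B.repr_self, Finsupp.smul_apply,
      smul_eq_mul] at h1
    refine mul_right_cancel₀ (hx0 i) (h1.trans ?_)
    by_cases hij : i = j
    · subst hij
      simp
      ring
    · simp [hij]
  have hαB : ∀ y : L, (α : H) • y = ((π * p) * B.repr y j) • B j := by
    intro y
    rw [← single_smul_of_diagonal hχ, ← hχα, LinearEquiv.symm_apply_apply]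
  have hstab : ∀ y : 𝓞 L, IsIntegral ℤ (((π * p) * B.repr (y : L) j) • B j) := by
    intro y
    rw [← hαB]
    exact α.2 _ y.isIntegral_coe
  by_cases hpP : (p : 𝓞 K) ∈ P
  · -- the residue characteristic is `p`
    obtain ⟨t, ht⟩ : s ∣ r * (p : 𝓞 K) := by
      rw [← Ideal.mem_span_singleton, hsI, mul_comm P]
      exact Ideal.mul_mem_mul hrI hpP
    have htK : (t : K) = π * p := by
      have h2 := congrArg (fun y : 𝓞 K => (y : K)) ht
      simp only [map_mul, map_natCast] at h2
      refine mul_left_cancel₀ hsK ?_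
      rw [← mul_assoc, hsπ]
      exact h2.symm
    have htP : t ∉ P := by
      intro htP
      have h1 : r * (p : 𝓞 K) ∈ P ^ 2 := by
        rw [ht, sq]
        exact Ideal.mul_mem_mul hsP htP
      rcases Ideal.IsPrime.mul_mem_pow P h1 with h | h
      · exact hrP h
      · exact hunr.notMem_sq hp hprime h
    have hdeg : Module.finrank K L = p := by
      rw [Module.finrank_eq_card_basis B, Fintype.card_fin]
    obtain ⟨y, hy⟩ := htame.exists_intTrace_notMem hp hdeg hprime hpP
    obtain ⟨z, hz, hzJ⟩ := hJ y
    obtain ⟨m, hm⟩ := exists_coe_eq_of_isIntegral (hstab y)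
    -- The component of p y at 0 is Tr(y), which tameness allows to be chosen outside P.
    have hz0 : z 0 = algebraMap (𝓞 K) (𝓞 L) (Algebra.intTrace (𝓞 K) (𝓞 L) y) := by
      apply NumberField.RingOfIntegers.ext
      have h1 : ((algebraMap (𝓞 K) (𝓞 L) (Algebra.intTrace (𝓞 K) (𝓞 L) y) : 𝓞 L) : L) =
        algebraMap K L (Algebra.intTrace (𝓞 K) (𝓞 L) y : K) := rfl
      have h2 : (Algebra.intTrace (𝓞 K) (𝓞 L) y : K) = Algebra.trace K L (y : L) :=
        Algebra.algebraMap_intTrace (A := 𝓞 K) (B := 𝓞 L) y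
      rw [h1, h2, trace_eq_mul_repr hB hω, hz, hB, Fin.val_zero, pow_zero, Algebra.smul_def, mul_one, map_mul, map_natCast]
    have hzj : algebraMap (𝓞 K) (𝓞 L) t * z j = (p : 𝓞 L) * m := by
      apply NumberField.RingOfIntegers.ext
      have h1 : ((algebraMap (𝓞 K) (𝓞 L) t * z j : 𝓞 L) : L) = algebraMap K L (t : K) * (z j : L) :=
        rfl
      have h2 : (((p : 𝓞 L) * m : 𝓞 L) : L) = (p : L) * (m : L) := by simp
      rw [h1, h2, hm, hz, htK]
      simp only [Algebra.smul_def, map_mul]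
      ring
    -- t Tr(y) = p m - t (z_j - z_0) ∈ J, so p divides t Tr(y), although neither factor lies in P.
    have hmem : algebraMap (𝓞 K) (𝓞 L) (t * Algebra.intTrace (𝓞 K) (𝓞 L) y) ∈ J := by
      have : algebraMap (𝓞 K) (𝓞 L) (t * Algebra.intTrace (𝓞 K) (𝓞 L) y) =
          m * (p : 𝓞 L) - algebraMap (𝓞 K) (𝓞 L) t * (z j - z 0) := by
        rw [map_mul, ← hz0, mul_comm m, ← hzj]
        ring
      rw [this]
      exact J.sub_mem (J.mul_mem_left _ hJp) (J.mul_mem_left _ (hzJ j 0))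
    have hdvd := hJK _ hmem
    rcases hprime.mem_or_mem (P.mem_of_dvd hdvd hpP) with h | h
    · exact htP h
    · exact hy h
  · -- the residue characteristic is not `p`
    -- Iterating π p e_j on w keeps integrality, so W is a common denominator for all powers of (π
    -- p)^p. Hence π p is integral, contradicting its exponent -1 at P.
    have hpow : ∀ n : ℕ, IsIntegral ℤ ((π * p) ^ n • (w : L)) := by
      intro n
      induction n with
      | zero => simpa using w.isIntegral_coe
      | succ n ih =>
        obtain ⟨y, hy⟩ := exists_coe_eq_of_isIntegral ih
        have := hstab y
        rw [hy, hwB, map_smul, map_smul, B.repr_self] at this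
        rw [hwB]
        convert this using 1
        rw [smul_smul]
        congr 1
        simp
        ring
    have halm : IsAlmostIntegral (𝓞 K) ((π * p) ^ p) := by
      refine ⟨W, mem_nonZeroDivisors_of_ne_zero hW0, fun n => ?_⟩
      have h1 : IsIntegral ℤ (((π * p) ^ p) ^ n * (W : K)) := by
        rw [← isIntegral_algHom_iff ((algebraMap K L).toIntAlgHom) (algebraMap K L).injective]
        change IsIntegral ℤ (algebraMap K L _)
        have : algebraMap K L (((π * p) ^ p) ^ n * (W : K)) = ((π * p) ^ n • (w : L)) ^ p := by
          rw [Algebra.smul_def, mul_pow (algebraMap K L _), hWL, map_mul, ← map_pow, ← pow_mul,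
            ← pow_mul, mul_comm p]
        rw [this]
        exact (hpow n).pow p
      obtain ⟨z, hz⟩ := exists_coe_eq_of_isIntegral h1
      refine ⟨z, ?_⟩
      rw [Algebra.smul_def, mul_comm]
      exact hz
    have hθ : IsIntegral ℤ (π * p) :=
      IsIntegral.of_pow hp.pos (isIntegral_trans (R := ℤ) (A := 𝓞 K) _ halm.isIntegral)
    obtain ⟨θ, hθ⟩ := exists_coe_eq_of_isIntegral hθ
    have : s * θ = r * (p : 𝓞 K) := by
      apply NumberField.RingOfIntegers.ext
      simp only [NumberField.RingOfIntegers.coe_eq_algebraMap, map_mul, map_natCast] at hθ hsπ ⊢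
      rw [hθ, ← mul_assoc, hsπ]
    have h2 : r * (p : 𝓞 K) ∈ P := this ▸ P.mul_mem_right _ hsP
    rcases hprime.mem_or_mem h2 with h | h
    · exact hrP h
    · exact hpP h

/-- With x_j the coordinates of x, take β = w_1 = p x_1 ω and c_j = (p x_1)^j/(p x_j). Then β^j/c_j
= p x_j ω^j sums to p x, and c_j^p W_j = W_1^j with all exponents of W_j below p identifies (c_j) as
the associated ideal. -/
theorem exists_isCriterionDatum_of_isFreeGenerator (hp : p.Prime)
    (hunr : IsUnramifiedIn K p) (htame : IsTame K L) {ω : L} {a : K}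
    (hL : IntermediateField.adjoin K {ω} = ⊤) (hB : ∀ j, B j = ω ^ (j : ℕ))
    (hω : ω ^ p = algebraMap K L a)
    (hχ : ∀ h j, h • B j = χ h j • B j) {x : 𝓞 L} (hx : IsFreeGenerator (associatedOrder L H) x) :
    ∃ (β : 𝓞 L) (c : Fin p → 𝓞 K), IsCriterionDatum p β c := by
  have : NeZero p := ⟨hp.ne_zero⟩
  have hpK : (p : K) ≠ 0 := Nat.cast_ne_zero.2 hp.ne_zero
  obtain ⟨J, hJp, hJK, hJ⟩ := exists_congruenceIdeal hp hunr B hB hω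
  have hint : ∀ (y : 𝓞 L) (j), IsIntegral ℤ ((p : L) * (B.repr (y : L) j • B j)) := by
    intro y j
    obtain ⟨z, hz, -⟩ := hJ y
    rw [← hz]
    exact (z j).isIntegral_coe
  have hω0 : ω ≠ 0 := by
    have := B.ne_zero ⟨1, hp.one_lt⟩
    simpa [hB] using this
  have ha0 : a ≠ 0 := by
    rintro rfl
    simp [hω0] at hω
  have hx0 : ∀ j, B.repr (x : L) j ≠ 0 :=
    repr_ne_zero_of_smul_eq_zero (H := H) hp.ne_zero hχ hint
      fun α hα => hx.1 (by simpa using hα)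
  obtain ⟨w, hw, -⟩ := hJ x
  have hwω : ∀ j, (w j : L) = algebraMap K L (p * B.repr (x : L) j) * ω ^ (j : ℕ) := by
    intro j
    rw [hw, hB, Algebra.smul_def, map_mul, map_natCast, mul_assoc]
  have hwp : ∀ j, (w j : L) ^ p =
      algebraMap K L ((p * B.repr (x : L) j) ^ p * a ^ (j : ℕ)) := by
    intro j
    rw [hwω, mul_pow, ← pow_mul, mul_comm (j : ℕ), pow_mul, hω, ← map_pow, ← map_pow, ← map_mul]
  have hWex : ∀ j, ∃ W : 𝓞 K, (W : K) = (p * B.repr (x : L) j) ^ p * a ^ (j : ℕ) := by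
    intro j
    refine exists_coe_eq_of_isIntegral ?_
    rw [← isIntegral_algHom_iff ((algebraMap K L).toIntAlgHom) (algebraMap K L).injective]
    change IsIntegral ℤ (algebraMap K L _)
    rw [← hwp]
    exact (w j).isIntegral_coe.pow p
  choose W hW using hWex
  have hWw : ∀ j, algebraMap (𝓞 K) (𝓞 L) (W j) = w j ^ p := by
    intro j
    apply NumberField.RingOfIntegers.ext
    have h1 : ((algebraMap (𝓞 K) (𝓞 L) (W j) : 𝓞 L) : L) = algebraMap K L (W j : K) := rfl
    have h2 : ((w j ^ p : 𝓞 L) : L) = (w j : L) ^ p := by simp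
    rw [h1, h2, hW, hwp]
  have hW0 : ∀ j, W j ≠ 0 := by
    intro j h
    have h1 := hW j
    rw [h, show ((0 : 𝓞 K) : K) = 0 from rfl] at h1
    exact mul_ne_zero (pow_ne_zero _ (mul_ne_zero hpK (hx0 j))) (pow_ne_zero _ ha0) h1.symm
  let i₁ : Fin p := ⟨1, hp.one_lt⟩
  have hcex : ∀ j : Fin p, ∃ z : 𝓞 K,
      (z : K) = (p * B.repr (x : L) i₁) ^ (j : ℕ) / (p * B.repr (x : L) j) ∧
      associatedIdeal p (Ideal.span {W i₁}) j = Ideal.span {z} := by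
    intro j
    refine exists_generator_associatedIdeal hp.pos (hW0 i₁) (hW0 j) (fun P hP =>
      primeExponent_lt_of_isFreeGenerator hp hunr htame hB hω hχ hJp hJK hJ hx hx0 (hw j) (hWw j)
        (hW0 j) hP) ?_
    have h1 : ((W i₁ ^ (j : ℕ) : 𝓞 K) : K) = (W i₁ : K) ^ (j : ℕ) := by simp
    rw [h1, hW, hW]
    have := mul_ne_zero hpK (hx0 j)
    have h2 : (i₁ : ℕ) = 1 := rfl
    rw [h2, pow_one, div_pow, mul_pow (_ ^ p), ← pow_mul, ← pow_mul, mul_comm p]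
    field_simp
  choose c hc hcI using hcex
  refine ⟨w i₁, c, ?_, ⟨W i₁, hWw i₁, hcI⟩, x, ?_⟩
  · rw [eq_top_iff, ← hL, IntermediateField.adjoin_simple_le_iff]
    have h1 : ω = algebraMap K L (p * B.repr (x : L) i₁)⁻¹ * (w i₁ : L) := by
      rw [hwω, ← mul_assoc, ← map_mul, inv_mul_cancel₀ (mul_ne_zero hpK (hx0 i₁)), map_one, one_mul,
        show (i₁ : ℕ) = 1 from rfl, pow_one]
    rw [h1]
    exact mul_mem (algebraMap_mem _ _) (IntermediateField.mem_adjoin_simple_self K _)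
  · conv_rhs => rw [← B.sum_repr (x : L)]
    rw [radicalSum, Finset.mul_sum]
    refine Finset.sum_congr rfl fun j _ => ?_
    rw [hc, hwω, hB, show (i₁ : ℕ) = 1 from rfl, pow_one, mul_pow, map_div₀, map_pow,
      Algebra.smul_def, map_mul (algebraMap K L) _ (B.repr (x : L) j), map_natCast]
    have h1 : algebraMap K L (p * B.repr (x : L) i₁) ≠ 0 :=
      (map_ne_zero _).2 (mul_ne_zero hpK (hx0 i₁))
    have h2 : algebraMap K L (B.repr (x : L) j) ≠ 0 := (map_ne_zero _).2 (hx0 j)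
    have h3 : (p : L) ≠ 0 := Nat.cast_ne_zero.2 hp.ne_zero
    field_simp

end Necessity

end HopfGaloisRadical

end

noncomputable section

namespace HopfGaloisRadical

/-! ### The Hopf algebra of functions on a finite abelian group -/

section FunctionHopfAlgebra

/-- The algebra of `K`-valued functions on a finite abelian group, dual to the group algebra. -/
def GroupFunctions (G K : Type*) : Type _ := G → K

namespace GroupFunctions

variable {G K : Type*} [Field K]

instance : CommRing (GroupFunctions G K) := inferInstanceAs (CommRing (G → K))

instance : Algebra K (GroupFunctions G K) := inferInstanceAs (Algebra K (G → K))

variable [DecidableEq G]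

/-- The indicator function of an element. -/
def indicator (g : G) : GroupFunctions G K := (Pi.single g 1 : G → K)

theorem indicator_apply (g h : G) : (indicator g : GroupFunctions G K) h = if h = g then 1 else 0 :=
  Pi.single_apply ..

theorem indicator_mul (g h : G) : (indicator g * indicator h : GroupFunctions G K) =
    if g = h then indicator g else 0 := by
  funext k
  change (indicator g : GroupFunctions G K) k * (indicator h : GroupFunctions G K) k = _
  split_ifs with e
  · subst e; simp [indicator_apply]
  · change _ = (0 : K)
    rw [indicator_apply, indicator_apply]
    split_ifs with h1 h2 <;> simp_all

variable [Fintype G]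

theorem sum_smul_indicator (f : GroupFunctions G K) : ∑ g, f g • indicator g = f := by
  funext h
  have : (∑ g, f g • (indicator g : GroupFunctions G K)) h =
      ∑ g, f g * (indicator g : GroupFunctions G K) h := Finset.sum_apply ..
  rw [this, Finset.sum_eq_single h]
  · rw [indicator_apply, if_pos rfl, mul_one]
  · intro g _ hg
    rw [indicator_apply, if_neg hg.symm, mul_zero]
  · simp

theorem sum_indicator : ∑ g, (indicator g : GroupFunctions G K) = 1 := by
  rw [← sum_smul_indicator (1 : GroupFunctions G K)]
  exact Finset.sum_congr rfl fun g _ => (one_smul K _).symm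

variable [AddCommGroup G]

/-- The comultiplication dual to the addition of the group. -/
def comulMap : GroupFunctions G K →ₗ[K] GroupFunctions G K ⊗[K] GroupFunctions G K where
  toFun f := ∑ i, ∑ j, f (i + j) • (indicator i ⊗ₜ indicator j)
  map_add' f g := by
    simp only [← Finset.sum_add_distrib, ← add_smul]
    rfl
  map_smul' c f := by
    simp only [Finset.smul_sum, smul_smul]
    rfl

theorem comulMap_apply (f : GroupFunctions G K) :
    comulMap f = ∑ i, ∑ j, f (i + j) • (indicator i ⊗ₜ indicator j) := rfl

theorem comulMap_indicator (g : G) : comulMap (indicator g : GroupFunctions G K) =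
    ∑ i, indicator i ⊗ₜ indicator (g - i) := by
  rw [comulMap_apply]
  refine Finset.sum_congr rfl fun i _ => ?_
  rw [Finset.sum_eq_single (g - i)]
  · rw [indicator_apply, if_pos (add_sub_cancel i g), one_smul]
  · intro j _ hj
    rw [indicator_apply, if_neg, zero_smul]
    rintro rfl
    exact hj (add_sub_cancel_left i j).symm
  · simp

/-- Evaluation at the identity. -/
def counitMap : GroupFunctions G K →ₗ[K] K where
  toFun f := f 0
  map_add' _ _ := rfl
  map_smul' _ _ := rfl

omit [DecidableEq G] [Fintype G] in
theorem counitMap_apply (f : GroupFunctions G K) : counitMap f = f 0 := rfl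

omit [AddCommGroup G] in
theorem hom_ext {M : Type*} [AddCommGroup M] [Module K M] {φ ψ : GroupFunctions G K →ₗ[K] M}
    (h : ∀ g, φ (indicator g) = ψ (indicator g)) : φ = ψ := by
  ext f
  rw [← sum_smul_indicator f, map_sum, map_sum]
  exact Finset.sum_congr rfl fun g _ => by rw [map_smul, map_smul, h]

instance : Coalgebra K (GroupFunctions G K) where
  comul := comulMap
  counit := counitMap
  coassoc := by
    refine hom_ext fun g => ?_
    simp only [LinearMap.comp_apply, comulMap_indicator, map_sum, LinearMap.rTensor_tmul,
      LinearMap.lTensor_tmul, LinearEquiv.coe_coe, TensorProduct.sum_tmul,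
      TensorProduct.tmul_sum, TensorProduct.assoc_tmul]
    rw [Finset.sum_comm]
    refine Finset.sum_congr rfl fun i _ => ?_
    rw [← _root_.Equiv.sum_comp (Equiv.addLeft i)]
    refine Finset.sum_congr rfl fun j _ => ?_
    simp [sub_sub]
  rTensor_counit_comp_comul := by
    refine hom_ext fun g => ?_
    simp only [LinearMap.comp_apply, comulMap_indicator, map_sum, LinearMap.rTensor_tmul,
      counitMap_apply, indicator_apply, TensorProduct.mk_apply]
    rw [Finset.sum_eq_single 0]
    · simp
    · intro i _ hi
      rw [if_neg (Ne.symm hi), TensorProduct.zero_tmul]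
    · simp
  lTensor_counit_comp_comul := by
    refine hom_ext fun g => ?_
    simp only [LinearMap.comp_apply, comulMap_indicator, map_sum, LinearMap.lTensor_tmul,
      counitMap_apply, indicator_apply, LinearMap.flip_apply, TensorProduct.mk_apply]
    rw [Finset.sum_eq_single g]
    · simp
    · intro i _ hi
      rw [if_neg, TensorProduct.tmul_zero]
      intro h
      exact hi (sub_eq_zero.1 h.symm).symm
    · simp

theorem comul_apply (f : GroupFunctions G K) :
    Coalgebra.comul (R := K) f = ∑ i, ∑ j, f (i + j) • (indicator i ⊗ₜ indicator j) := rfl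

theorem comul_indicator (g : G) : Coalgebra.comul (R := K) (indicator g : GroupFunctions G K) =
    ∑ i, indicator i ⊗ₜ indicator (g - i) := comulMap_indicator g

theorem counit_apply (f : GroupFunctions G K) : Coalgebra.counit (R := K) f = f 0 := rfl

instance : Bialgebra K (GroupFunctions G K) :=
  Bialgebra.mk' K (GroupFunctions G K) rfl (fun {_ _} => rfl)
    (by
      simp only [comul_apply]
      rw [Algebra.TensorProduct.one_def, ← sum_indicator, TensorProduct.sum_tmul]
      refine Finset.sum_congr rfl fun i _ => ?_
      rw [TensorProduct.tmul_sum]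
      refine Finset.sum_congr rfl fun j _ => ?_
      rw [sum_indicator]
      exact one_smul K _)
    (by
      intro f g
      have hmul : ∀ i j k l : G,
          (f (i + j) • (indicator i ⊗ₜ[K] indicator j)) * (g (k + l) • (indicator k ⊗ₜ indicator l)) =
          if i = k then (if j = l then (f (i + j) * g (i + j)) •
            ((indicator i : GroupFunctions G K) ⊗ₜ[K] (indicator j : GroupFunctions G K)) else 0)
            else 0 := by
        intro i j k l
        rw [smul_mul_smul_comm, Algebra.TensorProduct.tmul_mul_tmul, indicator_mul, indicator_mul]
        split_ifs with h1 h2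
        · rw [h1, h2]
        · simp
        · simp
        · simp
      simp only [comul_apply, Finset.sum_mul, Finset.mul_sum, hmul]
      refine Finset.sum_congr rfl fun i _ => Finset.sum_congr rfl fun j _ => ?_
      simp only [Finset.sum_ite_irrel, Finset.sum_const_zero]
      rw [Finset.sum_ite_eq' _ i, if_pos (Finset.mem_univ i), Finset.sum_ite_eq' _ j,
        if_pos (Finset.mem_univ j)]
      rfl)

/-- Precomposition with negation. -/
def antipodeMap : GroupFunctions G K →ₗ[K] GroupFunctions G K where
  toFun f := fun g => f (-g)
  map_add' _ _ := rfl
  map_smul' _ _ := rfl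

omit [Fintype G] in
theorem antipodeMap_indicator (g : G) :
    antipodeMap (indicator g : GroupFunctions G K) = indicator (-g) := by
  funext h
  change (indicator g : GroupFunctions G K) (-h) = _
  simp only [indicator_apply, neg_eq_iff_eq_neg]

instance : HopfAlgebra K (GroupFunctions G K) where
  antipode := antipodeMap
  mul_antipode_rTensor_comul := by
    refine hom_ext fun g => ?_
    simp only [LinearMap.comp_apply, comul_indicator, map_sum, LinearMap.rTensor_tmul,
      antipodeMap_indicator, LinearMap.mul'_apply, indicator_mul, counit_apply, indicator_apply,
      Algebra.linearMap_apply]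
    split_ifs with hg
    · subst hg
      rw [map_one, ← sum_indicator, ← _root_.Equiv.sum_comp (Equiv.neg G)]
      simp
    · rw [map_zero]
      refine Finset.sum_eq_zero fun i _ => if_neg fun h => hg ?_
      have := congrArg (· + i) h
      simpa using this
  mul_antipode_lTensor_comul := by
    refine hom_ext fun g => ?_
    simp only [LinearMap.comp_apply, comul_indicator, map_sum, LinearMap.lTensor_tmul,
      antipodeMap_indicator, LinearMap.mul'_apply, indicator_mul, counit_apply, indicator_apply,
      Algebra.linearMap_apply]
    split_ifs with hg
    · subst hg
      rw [map_one, ← sum_indicator]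
      simp
    · rw [map_zero]
      refine Finset.sum_eq_zero fun i _ => if_neg fun h => hg ?_
      have := congrArg (· - i) h
      simpa [eq_comm] using this

instance : Coalgebra.IsCocomm K (GroupFunctions G K) where
  comm_comp_comul := by
    refine hom_ext fun g => ?_
    simp only [LinearMap.comp_apply, comul_indicator, map_sum, LinearEquiv.coe_coe,
      TensorProduct.comm_tmul]
    rw [← (Equiv.subLeft g).sum_comp]
    simp

end GroupFunctions

end FunctionHopfAlgebra

/-! ### Existence: the grading by exponents modulo p -/

section Existence

variable {K L : Type*} [Field K] [Field L] [Algebra K L] {p : ℕ} [NeZero p]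

/-- The functions on `Fin p` act on `L` through the coordinates in a basis. -/
abbrev gradedModule (B : Module.Basis (Fin p) K L) : Module (GroupFunctions (Fin p) K) L where
  smul h y := ∑ j, (h j * B.repr y j) • B j
  one_smul y := by
    change ∑ j, ((1 : K) * B.repr y j) • B j = y
    simp only [one_mul, B.sum_repr]
  mul_smul h h' y := by
    change ∑ j, (h j * h' j * B.repr y j) • B j =
      ∑ j, (h j * B.repr (∑ j, (h' j * B.repr y j) • B j) j) • B j
    simp only [B.repr_sum_self, mul_assoc]
  smul_zero h := by
    change ∑ j, (h j * B.repr 0 j) • B j = 0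
    simp
  smul_add h x y := by
    change ∑ j, (h j * B.repr (x + y) j) • B j =
      ∑ j, (h j * B.repr x j) • B j + ∑ j, (h j * B.repr y j) • B j
    simp only [map_add, Finsupp.add_apply, mul_add, add_smul, Finset.sum_add_distrib]
  add_smul h h' y := by
    change ∑ j, ((h j + h' j) * B.repr y j) • B j =
      ∑ j, (h j * B.repr y j) • B j + ∑ j, (h' j * B.repr y j) • B j
    simp only [add_mul, add_smul, Finset.sum_add_distrib]
  zero_smul y := by
    change ∑ j, ((0 : K) * B.repr y j) • B j = 0
    simp

/-- The grading of a radical extension by the exponents gives a Hopf-Galois structure. -/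
theorem exists_isHopfGalois {K : Type u} [Field K] [Algebra K L] {β : L} {b : K}
    (B : Module.Basis (Fin p) K L)
    (hB : ∀ j, B j = β ^ (j : ℕ)) (hb : β ^ p = algebraMap K L b) :
    ∃ (H : Type u) (_ : Ring H) (_ : HopfAlgebra K H) (_ : Module H L)
      (_ : IsScalarTower K H L), IsHopfGalois K L H := by
  let := gradedModule B
  have hsmul : ∀ (h : GroupFunctions (Fin p) K) (y : L), h • y = ∑ j, (h j * B.repr y j) • B j :=
    fun _ _ => rfl
  have htower : IsScalarTower K (GroupFunctions (Fin p) K) L := by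
    refine ⟨fun c h y => ?_⟩
    rw [hsmul, hsmul, Finset.smul_sum]
    refine Finset.sum_congr rfl fun j _ => ?_
    rw [smul_smul, ← mul_assoc]
    rfl
  have hsingle : ∀ (i : Fin p) (y : L),
      (GroupFunctions.indicator i : GroupFunctions (Fin p) K) • y = B.repr y i • B i := by
    intro i y
    rw [hsmul, Finset.sum_eq_single i]
    · simp [GroupFunctions.indicator_apply]
    · intro j _ hj
      simp [GroupFunctions.indicator_apply, hj]
    · simp
  have hprod : ∀ i j : Fin p, ∃ c : K, B i * B j = c • B (i + j) := by
    intro i j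
    have hval : ((i + j : Fin p) : ℕ) = ((i : ℕ) + j) % p := Fin.val_add i j
    -- Addition in `Fin p` is modulo p, and each carry contributes a factor β^p = b.
    refine ⟨b ^ (((i : ℕ) + j) / p), ?_⟩
    rw [hB, hB, hB, hval, ← pow_add, Algebra.smul_def, map_pow, ← hb, ← pow_mul, ← pow_add,
      Nat.div_add_mod]
  have hact : ∀ (h : GroupFunctions (Fin p) K) (i j : Fin p),
      h • (B i * B j) = h (i + j) • (B i * B j) := by
    intro h i j
    obtain ⟨c, hc⟩ := hprod i j
    rw [hc, hsmul, Finset.sum_eq_single (i + j)]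
    · simp [smul_smul]
    · intro k _ hk
      simp [hk]
    · simp
  have hlin : ∀ (h : GroupFunctions (Fin p) K) (c : K) (y : L), h • (c • y) = c • (h • y) :=
    fun h c y => (Algebra.lsmul K K L h : L →ₗ[K] L).map_smul c y
  have hfin : FiniteDimensional K L := Module.Basis.finiteDimensional_of_finite B
  have hfinH : FiniteDimensional K (GroupFunctions (Fin p) K) :=
    inferInstanceAs (FiniteDimensional K (Fin p → K))
  refine ⟨GroupFunctions (Fin p) K, inferInstance, inferInstance, this, htower,
    inferInstance, ?_, ?_, ?_⟩
  · intro h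
    have h1 : (1 : L) = B 0 := by rw [hB, Fin.val_zero, pow_zero]
    rw [GroupFunctions.counit_apply, hsmul, Finset.sum_eq_single 0]
    · rw [Algebra.algebraMap_eq_smul_one, h1]
      simp
    · intro j _ hj
      rw [h1]
      simp [hj]
    · simp
  · intro h x y
    rw [GroupFunctions.comul_apply]
    simp only [map_sum, map_smul, TensorProduct.map_tmul, LinearMap.mul'_apply]
    have horb : ∀ (i : Fin p) (z : L), orbitMap K L (GroupFunctions (Fin p) K) z
        (GroupFunctions.indicator i) = B.repr z i • B i := fun i z => hsingle i z
    simp only [horb]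
    conv_lhs => rw [← B.sum_repr x, ← B.sum_repr y]
    rw [Finset.sum_mul_sum, Finset.smul_sum]
    refine Finset.sum_congr rfl fun i _ => ?_
    rw [Finset.smul_sum]
    refine Finset.sum_congr rfl fun j _ => ?_
    rw [smul_mul_smul_comm, hlin, hact, smul_comm]
  · have hB0 : ∀ i, B i ≠ 0 := fun i => B.ne_zero i
    have hsurj : Function.Surjective (galoisMap K L (GroupFunctions (Fin p) K)) := by
      intro T
      -- The indicator of i projects to the line of B i, and multiplication by T(B i)/B i then
      -- agrees with T on that line.
      refine ⟨∑ i, (T (B i) * (B i)⁻¹) ⊗ₜ GroupFunctions.indicator i, ?_⟩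
      ext y
      rw [map_sum, LinearMap.sum_apply]
      conv_rhs => rw [← B.sum_repr y]
      rw [map_sum]
      refine Finset.sum_congr rfl fun i _ => ?_
      have : galoisMap K L (GroupFunctions (Fin p) K)
          ((T (B i) * (B i)⁻¹) ⊗ₜ GroupFunctions.indicator i) y =
          (T (B i) * (B i)⁻¹) * ((GroupFunctions.indicator i : GroupFunctions (Fin p) K) • y) := rfl
      rw [this, hsingle, map_smul, mul_smul_comm, mul_assoc, inv_mul_cancel₀ (hB0 i), mul_one]
    refine ⟨(LinearMap.injective_iff_surjective_of_finrank_eq_finrank ?_).2 hsurj, hsurj⟩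
    have hH : Module.finrank K (GroupFunctions (Fin p) K) = p :=
      (Module.finrank_fintype_fun_eq_card K).trans (Fintype.card_fin p)
    rw [Module.finrank_tensorProduct, Module.finrank_linearMap, hH,
      Module.finrank_eq_card_basis B, Fintype.card_fin]

end Existence

end HopfGaloisRadical

end

noncomputable section

namespace HopfGaloisRadical

/-- Adjoining a `p`-th root of an element that is not a `p`-th power gives an extension of
degree `p`. -/
theorem finrank_eq_of_pow_eq {K L : Type*} [Field K] [Field L] [Algebra K L] {p : ℕ}
    (hp : p.Prime) {ω : L} (hL : IntermediateField.adjoin K {ω} = ⊤) {a : K}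
    (hω : ω ^ p = algebraMap K L a) (ha : ∀ c : K, c ^ p ≠ a) : Module.finrank K L = p := by
  have hirr := X_pow_sub_C_irreducible_of_prime hp ha
  have hmonic := Polynomial.monic_X_pow_sub_C a hp.ne_zero
  have hroot : Polynomial.aeval ω (Polynomial.X ^ p - Polynomial.C a) = 0 := by
    simp [hω]
  have hint : IsIntegral K ω := ⟨_, hmonic, hroot⟩
  rw [← IntermediateField.finrank_top', ← hL, IntermediateField.adjoin.finrank hint,
    ← minpoly.eq_of_irreducible_of_monic hirr hroot hmonic, Polynomial.natDegree_X_pow_sub_C]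

end HopfGaloisRadical

end

theorem mainTheorem1 (p : ℕ) (hp : p.Prime)
    (K : Type u) [Field K] [NumberField K] (hζ : ∀ z : K, ¬ IsPrimitiveRoot z p)
    (hunr : IsUnramifiedIn K p)
    (L : Type v) [Field L] [NumberField L] [Algebra K L]
    (ω : L) (hL : IntermediateField.adjoin K {ω} = ⊤)
    (a : K) (hω : ω ^ p = algebraMap K L a) (ha : ∀ c : K, c ^ p ≠ a)
    (htame : IsTame K L) :
    -- a Hopf-Galois structure on `L/K` exists
    (∃ (H : Type u) (_ : Ring H) (_ : HopfAlgebra K H) (_ : Module H L)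
      (_ : IsScalarTower K H L), IsHopfGalois K L H) ∧
    -- the criterion for the associated order in the Hopf-Galois structure
    ∀ (H : Type w) [Ring H] [HopfAlgebra K H] [Module H L] [IsScalarTower K H L],
      IsHopfGalois K L H →
        (Module.Free (associatedOrder L H) (𝓞 L) ↔
          ∃ (β : 𝓞 L) (c : Fin p → 𝓞 K), IsCriterionDatum p β c) ∧
        ∀ (β : 𝓞 L) (c : Fin p → 𝓞 K), IsCriterionDatum p β c →
          ∃ x : 𝓞 L, (x : L) = 1 / (p : L) * radicalSum p β c ∧
            IsFreeGenerator (associatedOrder L H) x := by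
  have : NeZero p := ⟨hp.ne_zero⟩
  have hdeg := finrank_eq_of_pow_eq hp hL hω ha
  obtain ⟨B, hB⟩ := exists_basis_pow hp hdeg hL
  refine ⟨exists_isHopfGalois B hB hω, fun H _ _ _ _ hH => ⟨⟨fun hfree => ?_, ?_⟩,
    fun β c hd => hd.exists_isFreeGenerator hp hunr hdeg hH⟩⟩
  · obtain ⟨χ, hχ⟩ := hH.exists_diagonal hp B hB hω
    obtain ⟨J, -, -, hJ⟩ := exists_congruenceIdeal hp hunr B hB hω
    have hint : ∀ (y : 𝓞 L) (j), IsIntegral ℤ ((p : L) * (B.repr (y : L) j • B j)) := by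
      intro y j
      obtain ⟨z, hz, -⟩ := hJ y
      rw [← hz]
      exact (z j).isIntegral_coe
    have hB0 : B 0 = 1 := by rw [hB, Fin.val_zero, pow_zero]
    obtain ⟨x, hx⟩ := exists_isFreeGenerator_of_free hχ hB0 hint hfree
    exact exists_isCriterionDatum_of_isFreeGenerator hp hunr htame hL hB hω hχ hx
  · rintro ⟨β, c, hd⟩
    obtain ⟨x, -, hx⟩ := hd.exists_isFreeGenerator hp hunr hdeg hH
    exact hx.free
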